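/- Let $(M,g)$ be a connected smooth Riemannian manifold without boundary (Hausdorff, $\sigma$-compact; not assumed complete, so that the interior of a compact Riemannian manifold with boundary is allowed), with Riemannian measure $d\sigma_g$, and let $1<p<\infty$. Let $W_0^{1,p}(M)$ be the closure of the smooth compactly supported functions $C_c^\infty(M)$ for the norm $\|u\|_{W^{1,p}}=\|\nabla u\|_{L^p}+\|u\|_{L^p}$. Let $f:(0,\infty)\to(0,\infty)$ be continuous with $s\mapsto f(s)/s^{p-1}$ strictly decreasing, and let $h:M\to\mathbb R$ satisfy $h\ge 0$ almost everywhere and not $h=0$ almost everywhere. Suppose $u,v\in W_0^{1,p}(M)\cap C^1(M)$ satisfy $u>0$ and $v>0$ in $M$ and $$-\Delta_p u\ \ge\ h\,f(u),\qquad -\Delta_p v\ \le\ h\,f(v)\qquad\text{in } M$$ in the weak sense, that is: $h f(u)$ and $h f(v)$ are locally integrable and, for every $\varphi\in C_c^\infty(M)$ with $\varphi\ge 0$, $$\int_M|\nabla u|^{p-2}\langle\nabla u,\nabla\varphi\rangle\,d\sigma_g\ \ge\ \int_M h f(u)\varphi\,d\sigma_g,\qquad \int_M|\nabla v|^{p-2}\langle\nabla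 v,\nabla\varphi\rangle\,d\sigma_g\ \le\ \int_M h f(v)\varphi\,d\sigma_g .$$ Then $u\ge v$ everywhere in $M$. (The case $h\equiv 1$ is the comparison principle for $-\Delta_p u\ge f(u)$, $-\Delta_p v\le f(v)$.) -/

import Mathlib

open MeasureTheory Set Bundle
open scoped Manifold ContDiff ENNReal

noncomputable section

namespace RiemPLaplace

/-- The smooth partition of unity (indexed by the centres of the preferred charts) used to
integrate over `M`: the support of the `c`-th function lies in the domain of the chart at `c`. -/
def chartPartition (n : ℕ) (M : Type*) [TopologicalSpace M]
    [ChartedSpace (EuclideanSpace ℝ (Fin n)) M] [IsManifold (𝓡 n) ∞ M]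
    [T2Space M] [SigmaCompactSpace M] :
    SmoothPartitionOfUnity M (𝓡 n) M univ :=
  (SmoothPartitionOfUnity.exists_isSubordinate_chartAt_source (𝓡 n) M).choose

theorem chartPartition_isSubordinate (n : ℕ) (M : Type*) [TopologicalSpace M]
    [ChartedSpace (EuclideanSpace ℝ (Fin n)) M] [IsManifold (𝓡 n) ∞ M]
    [T2Space M] [SigmaCompactSpace M] :
    (chartPartition n M).IsSubordinate
      (fun c : M => (chartAt (EuclideanSpace ℝ (Fin n)) c).source) :=
  (SmoothPartitionOfUnity.exists_isSubordinate_chartAt_source (𝓡 n) M).choose_spec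

section

variable {n : ℕ} {M : Type*} [TopologicalSpace M]
  [ChartedSpace (EuclideanSpace ℝ (Fin n)) M] [IsManifold (𝓡 n) ∞ M]
  [RiemannianBundle (fun x : M => TangentSpace (𝓡 n) x)]

/-- The coordinate vector field `∂ᵢ` of the chart at `c`, at the point with coordinates `y`. -/
def coordVec (c : M) (y : EuclideanSpace ℝ (Fin n)) (i : Fin n) :
    TangentSpace (𝓡 n) ((chartAt (EuclideanSpace ℝ (Fin n)) c).symm y) :=
  mfderiv (𝓡 n) (𝓡 n) (chartAt (EuclideanSpace ℝ (Fin n)) c).symm y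
    (EuclideanSpace.single i (1 : ℝ) : EuclideanSpace ℝ (Fin n))

/-- The volume density `√(det (g_ij))` in the chart at `c`, where `g_ij = ⟨∂ᵢ, ∂ⱼ⟩`. -/
def volDensity (c : M) (y : EuclideanSpace ℝ (Fin n)) : ℝ :=
  √(Matrix.of fun i j : Fin n => inner ℝ (coordVec c y i) (coordVec c y j)).det

/-- The Riemannian measure: `∫ f = ∑_c ∫ (η_c f) ∘ φ_c⁻¹ √(det g) dy`, with `φ_c` the charts and
`η_c` a subordinate partition of unity. -/
def riemVol (n : ℕ) (M : Type*) [TopologicalSpace M]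
    [ChartedSpace (EuclideanSpace ℝ (Fin n)) M] [IsManifold (𝓡 n) ∞ M]
    [RiemannianBundle (fun x : M => TangentSpace (𝓡 n) x)]
    [T2Space M] [SigmaCompactSpace M] [MeasurableSpace M] : Measure M :=
  Measure.sum fun c : M =>
    (Measure.map (chartAt (EuclideanSpace ℝ (Fin n)) c).symm
      ((volume.restrict (chartAt (EuclideanSpace ℝ (Fin n)) c).target).withDensity
        fun y => ENNReal.ofReal (volDensity c y))).withDensity
      fun x => ENNReal.ofReal (chartPartition n M c x)

/-- The Riemannian gradient: `⟨∇u(x), w⟩ = du(x) w` for all tangent vectors `w` at `x`. -/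
def grad (u : M → ℝ) (x : M) : TangentSpace (𝓡 n) x :=
  haveI : FiniteDimensional ℝ (TangentSpace (𝓡 n) x) :=
    inferInstanceAs (FiniteDimensional ℝ (EuclideanSpace ℝ (Fin n)))
  haveI : CompleteSpace (TangentSpace (𝓡 n) x) := FiniteDimensional.complete ℝ _
  (InnerProductSpace.toDual ℝ (TangentSpace (𝓡 n) x)).symm
    (mfderiv (𝓡 n) 𝓘(ℝ, ℝ) u x : TangentSpace (𝓡 n) x →L[ℝ] ℝ)

theorem inner_grad (u : M → ℝ) (x : M) (w : TangentSpace (𝓡 n) x) :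
    inner ℝ (grad u x) w = (mfderiv (𝓡 n) 𝓘(ℝ, ℝ) u x w : ℝ) := by
  have : FiniteDimensional ℝ (TangentSpace (𝓡 n) x) :=
    inferInstanceAs (FiniteDimensional ℝ (EuclideanSpace ℝ (Fin n)))
  have : CompleteSpace (TangentSpace (𝓡 n) x) := FiniteDimensional.complete ℝ _
  exact InnerProductSpace.toDual_symm_apply

variable [T2Space M] [SigmaCompactSpace M] [MeasurableSpace M]

/-- The norm `‖u‖_{W^{1,p}} = ‖∇u‖_p + ‖u‖_p` of a `C¹` function (possibly infinite). -/
def sobolevNorm (p : ℝ) (u : M → ℝ) : ℝ≥0∞ :=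
  eLpNorm (fun x => ‖grad (n := n) u x‖) (ENNReal.ofReal p) (riemVol n M) +
    eLpNorm u (ENNReal.ofReal p) (riemVol n M)

/-- `u ∈ W₀^{1,p}(M) ∩ C¹(M)`: a `C¹` function that is a limit, in the norm of `W^{1,p}(M)`, of
smooth functions with compact support. -/
def MemW0C1 (p : ℝ) (u : M → ℝ) : Prop :=
  ContMDiff (𝓡 n) 𝓘(ℝ, ℝ) 1 u ∧
    ∀ ε : ℝ≥0∞, 0 < ε → ∃ φ : M → ℝ, ContMDiff (𝓡 n) 𝓘(ℝ, ℝ) ∞ φ ∧ HasCompactSupport φ ∧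
      sobolevNorm (n := n) p (fun x => u x - φ x) < ε

/-- `⟨-Δ_p u, φ⟩ = ∫ |∇u|^{p-2} ⟨∇u, ∇φ⟩` for a `C¹` function `u`. -/
def pLaplacePairing (p : ℝ) (u φ : M → ℝ) : ℝ :=
  ∫ x, ‖grad (n := n) u x‖ ^ (p - 2) * inner ℝ (grad (n := n) u x) (grad (n := n) φ x)
    ∂(riemVol n M)

/-- `-Δ_p u ≥ F` in the weak sense (which presupposes that `F` is locally integrable). -/
def WeakSupersolution (p : ℝ) (u F : M → ℝ) : Prop :=
  LocallyIntegrable F (riemVol n M) ∧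
    ∀ φ : M → ℝ, ContMDiff (𝓡 n) 𝓘(ℝ, ℝ) ∞ φ → HasCompactSupport φ → (∀ x, 0 ≤ φ x) →
      ∫ x, F x * φ x ∂(riemVol n M) ≤ pLaplacePairing (n := n) p u φ

/-- `-Δ_p u ≤ F` in the weak sense (which presupposes that `F` is locally integrable). -/
def WeakSubsolution (p : ℝ) (u F : M → ℝ) : Prop :=
  LocallyIntegrable F (riemVol n M) ∧
    ∀ φ : M → ℝ, ContMDiff (𝓡 n) 𝓘(ℝ, ℝ) ∞ φ → HasCompactSupport φ → (∀ x, 0 ≤ φ x) →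
      pLaplacePairing (n := n) p u φ ≤ ∫ x, F x * φ x ∂(riemVol n M)

end

end RiemPLaplace

end

/-!
The comparison rests on a Picone-type argument. Put `r = v / u` and let `β(r) =
smoothTransition (r - 1)`, a nonnegative nondecreasing function that vanishes for `r ≤ 1`. Formally
one tests the inequality for `u` with `u r^p β(r)`, the one for `v` with `v β(r)`, and subtracts.
The source terms leave the integral of `h β(r) v^p (f(u)/u^{p-1} - f(v)/v^{p-1})`, which is
nonnegative because `β(r) ≠ 0` forces `v > u`. By the convexity of `|X|^p`, the gradient terms are
at most `-β'(r) r ⟨A(r∇u) - A(∇v), r∇u - ∇v⟩` with `A(X) = |X|^{p-2} X`, and `A` is monotone.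
So both the source integrand and this monotonicity defect vanish.

These test functions need not be compactly supported, nor integrable against the data. Since `v` is
a limit in `W^{1,p}` of functions `φ_k ∈ C_c^∞`, the cut-offs `ζ_k = smoothTransition (φ_k / v)`
have compact support, take values in `[0, 1]`, tend to `1` almost everywhere, and satisfy
`∫ |v ∇ζ_k|^p → 0` (`MemW0C1.exists_cutoff`). With `v ζ_k` in place of `v` inside `r`, the pointwise
inequality `picone_le` bounds the error by products of `|∇u|^{p-1} + |∇v|^{p-1}` with `|v ∇ζ_k|`,
up to a `p`-th power of the latter; Young's inequality and Fatou's lemma then give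
`ae_gap_one_eq_zero`.

The test functions are only `C¹`. They are admissible because smooth functions are dense among
compactly supported `C¹` functions for uniform convergence of the function and its gradient
(`smoothlyApproximable_of_contMDiff`, by a partition of unity and mollification in charts) and the
Riemannian measure is finite on compact sets. This measure charges every nonempty open set, so the
vanishing of the continuous defect holds everywhere, not just almost everywhere.

Consequently `∇r = 0` wherever `β'(r) ≠ 0`. If `r > 1` at every point, the source terms force
`h = 0` almost everywhere, which is excluded. If `r` takes values both above `1` and at most `1`,
it takes, `M` being connected, some value `c > 1` with `β'(c) ≠ 0`; the level set `{r = c}` is then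
open and closed, hence all of `M`, a contradiction. So `r ≤ 1`.
-/

open Filter Topology

set_option linter.unusedSectionVars false

noncomputable section

namespace RiemPLaplace

/-! ### Real inequalities of Young type -/

section Young

theorem young_rpow {p a b : ℝ} (hp : 1 < p) (ha : 0 ≤ a) (hb : 0 ≤ b) :
    p * (a ^ (p - 1) * b) ≤ (p - 1) * a ^ p + b ^ p := by
  have hpq : (p.conjExponent).HolderConjugate p := (Real.HolderConjugate.conjExponent hp).symm
  have h := Real.young_inequality_of_nonneg (Real.rpow_nonneg ha (p - 1)) hb hpq
  have h1 : (a ^ (p - 1)) ^ p.conjExponent = a ^ p := by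
    rw [← Real.rpow_mul ha, Real.conjExponent]
    congr 1
    have : p - 1 ≠ 0 := by linarith
    field_simp
  rw [h1, Real.conjExponent] at h
  have hp1 : p - 1 ≠ 0 := by linarith
  have hp0 : p ≠ 0 := by linarith
  calc p * (a ^ (p - 1) * b) ≤ p * (a ^ p / (p / (p - 1)) + b ^ p / p) := by gcongr
    _ = _ := by field_simp

theorem exists_young_rpow {p ε : ℝ} (hp : 1 < p) (hε : 0 < ε) :
    ∃ K : ℝ, 0 ≤ K ∧ ∀ a b : ℝ, 0 ≤ a → 0 ≤ b → a ^ (p - 1) * b ≤ ε * a ^ p + K * b ^ p := by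
  have hp0 : 0 < p := by linarith
  obtain ⟨l, hl, hlε⟩ : ∃ l : ℝ, 0 < l ∧ l ^ p = ε :=
    ⟨ε ^ p⁻¹, by positivity, Real.rpow_inv_rpow hε.le hp0.ne'⟩
  refine ⟨((l ^ (p - 1))⁻¹) ^ p, by positivity, fun a b ha hb => ?_⟩
  have h := young_rpow hp (mul_nonneg hl.le ha)
    (mul_nonneg (inv_nonneg.2 (Real.rpow_nonneg hl.le (p - 1))) hb)
  rw [Real.mul_rpow hl.le ha, Real.mul_rpow hl.le ha, Real.mul_rpow (by positivity) hb, hlε] at h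
  have h1 : l ^ (p - 1) * a ^ (p - 1) * ((l ^ (p - 1))⁻¹ * b) = a ^ (p - 1) * b := by
    have : l ^ (p - 1) ≠ 0 := by positivity
    field_simp
  rw [h1] at h
  have h2 : 0 ≤ ε * a ^ p := by positivity
  have h3 : 0 ≤ ((l ^ (p - 1))⁻¹) ^ p * b ^ p := by positivity
  have h4 : 0 ≤ a ^ (p - 1) * b := by positivity
  have h5 : p * (a ^ (p - 1) * b) ≤ p * (ε * a ^ p + ((l ^ (p - 1))⁻¹) ^ p * b ^ p) := by
    nlinarith
  exact le_of_mul_le_mul_left h5 hp0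

theorem add_rpow_sub_one_le {p a b : ℝ} (hp : 1 < p) (ha : 0 ≤ a) (hb : 0 ≤ b) :
    (a + b) ^ (p - 1) ≤ 2 ^ (p - 1) * (a ^ (p - 1) + b ^ (p - 1)) := by
  have h0 : 0 ≤ p - 1 := by linarith
  have ha' := Real.rpow_nonneg ha (p - 1)
  have hb' := Real.rpow_nonneg hb (p - 1)
  rcases le_total a b with h | h
  · calc (a + b) ^ (p - 1) ≤ (2 * b) ^ (p - 1) := by gcongr; linarith
      _ = 2 ^ (p - 1) * b ^ (p - 1) := Real.mul_rpow (by norm_num) hb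
      _ ≤ _ := by gcongr; linarith
  · calc (a + b) ^ (p - 1) ≤ (2 * a) ^ (p - 1) := by gcongr; linarith
      _ = 2 ^ (p - 1) * a ^ (p - 1) := Real.mul_rpow (by norm_num) ha
      _ ≤ _ := by gcongr; linarith

/-- The cross terms in the comparison of the two tested inequalities are absorbed by an arbitrarily
small multiple of the energies, at the price of a large multiple of the cut-off error `w`. -/
theorem exists_absorb {p ε : ℝ} (hp : 1 < p) (hε : 0 < ε) {K₀ : ℝ} (hK₀ : 0 ≤ K₀) :
    ∃ K : ℝ, 0 ≤ K ∧ ∀ a b w : ℝ, 0 ≤ a → 0 ≤ b → 0 ≤ w →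
      K₀ * ((a ^ (p - 1) + b ^ (p - 1) + w ^ (p - 1)) * w) ≤ ε * (a ^ p + b ^ p) + K * w ^ p := by
  obtain ⟨K, hK, h⟩ := exists_young_rpow hp (show 0 < ε / (K₀ + 1) by positivity)
  refine ⟨K₀ * (2 * K + 1), by positivity, fun a b w ha hb hw => ?_⟩
  have h1 := h a w ha hw
  have h2 := h b w hb hw
  have h3 : w ^ (p - 1) * w = w ^ p := by
    rcases hw.eq_or_lt with rfl | hw
    · rw [Real.zero_rpow (by linarith : p ≠ 0)]; simp
    · rw [← Real.rpow_add_one hw.ne']; congr 1; ring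
  have h4 : 0 ≤ a ^ p + b ^ p := by positivity
  calc K₀ * ((a ^ (p - 1) + b ^ (p - 1) + w ^ (p - 1)) * w)
      = K₀ * (a ^ (p - 1) * w + b ^ (p - 1) * w + w ^ (p - 1) * w) := by ring
    _ ≤ K₀ * ((ε / (K₀ + 1) * a ^ p + K * w ^ p) + (ε / (K₀ + 1) * b ^ p + K * w ^ p) + w ^ p) := by
        rw [h3]; gcongr
    _ = (K₀ / (K₀ + 1)) * (ε * (a ^ p + b ^ p)) + K₀ * (2 * K + 1) * w ^ p := by
        field_simp; ring
    _ ≤ 1 * (ε * (a ^ p + b ^ p)) + K₀ * (2 * K + 1) * w ^ p := by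
        gcongr
        rw [div_le_one (by positivity)]; linarith
    _ = _ := by ring

end Young

/-! ### The nonlinearity of the p-Laplacian and the Picone-type inequality -/

section Flux

variable {E : Type*} [NormedAddCommGroup E] [InnerProductSpace ℝ E]

/-- The nonlinearity `X ↦ |X|^{p-2} X` of the `p`-Laplacian. -/
def pFlux (p : ℝ) (X : E) : E := ‖X‖ ^ (p - 2) • X

theorem inner_pFlux_self {p : ℝ} (hp : 1 < p) (X : E) : inner ℝ (pFlux p X) X = ‖X‖ ^ p := by
  rw [pFlux, real_inner_smul_left, real_inner_self_eq_norm_sq]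
  rcases eq_or_ne X 0 with rfl | hX
  · rw [norm_zero, Real.zero_rpow (by linarith : p ≠ 0)]; simp
  · rw [← Real.rpow_natCast, ← Real.rpow_add (norm_pos_iff.2 hX)]
    congr 1; push_cast; ring

theorem norm_pFlux {p : ℝ} (hp : 1 < p) (X : E) : ‖pFlux p X‖ = ‖X‖ ^ (p - 1) := by
  rw [pFlux, norm_smul, Real.norm_of_nonneg (by positivity)]
  rcases eq_or_ne X 0 with rfl | hX
  · rw [norm_zero, Real.zero_rpow (by linarith : p - 1 ≠ 0)]; simp
  · rw [← Real.rpow_add_one (norm_pos_iff.2 hX).ne']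
    congr 1; ring

theorem pFlux_smul {p : ℝ} (hp : 1 < p) {c : ℝ} (hc : 0 ≤ c) (X : E) :
    pFlux p (c • X) = c ^ (p - 1) • pFlux p X := by
  rcases hc.eq_or_lt with rfl | hc
  · rw [Real.zero_rpow (by linarith : p - 1 ≠ 0)]; simp [pFlux]
  · rw [pFlux, pFlux, norm_smul, Real.norm_of_nonneg hc.le, Real.mul_rpow hc.le (norm_nonneg _),
      smul_smul, smul_smul]
    congr 1
    rw [show p - 1 = p - 2 + 1 by ring, Real.rpow_add_one hc.ne']
    ring

theorem inner_pFlux_le {p : ℝ} (hp : 1 < p) (X Z : E) :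
    inner ℝ (pFlux p X) Z ≤ ‖X‖ ^ (p - 1) * ‖Z‖ := by
  rw [← norm_pFlux hp]
  exact real_inner_le_norm _ _

theorem neg_inner_pFlux_le {p : ℝ} (hp : 1 < p) (X Z : E) :
    -inner ℝ (pFlux p X) Z ≤ ‖X‖ ^ (p - 1) * ‖Z‖ := by
  rw [← norm_pFlux hp]
  exact (neg_le_abs _).trans (abs_real_inner_le_norm _ _)

/-- Convexity of `X ↦ |X|^p`. -/
theorem young_pFlux {p : ℝ} (hp : 1 < p) (X Z : E) :
    p * inner ℝ (pFlux p X) Z ≤ (p - 1) * ‖X‖ ^ p + ‖Z‖ ^ p :=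
  (mul_le_mul_of_nonneg_left (inner_pFlux_le hp X Z) (by linarith)).trans
    (young_rpow hp (norm_nonneg _) (norm_nonneg _))

/-- The monotonicity defect `⟨|X|^{p-2}X - |Y|^{p-2}Y, X - Y⟩` of the `p`-Laplacian. -/
def pDefect (p : ℝ) (X Y : E) : ℝ := inner ℝ (pFlux p X - pFlux p Y) (X - Y)

theorem le_pDefect {p : ℝ} (hp : 1 < p) (X Y : E) :
    (‖X‖ ^ (p - 1) - ‖Y‖ ^ (p - 1)) * (‖X‖ - ‖Y‖) ≤ pDefect p X Y := by
  have e : ∀ X : E, ‖X‖ ^ p = ‖X‖ ^ (p - 1) * ‖X‖ := fun X => by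
    rw [← inner_pFlux_self hp, pFlux, real_inner_smul_left, real_inner_self_eq_norm_mul_norm,
      ← mul_assoc]
    congr 1
    rw [← norm_pFlux hp, pFlux, norm_smul, Real.norm_of_nonneg (by positivity)]
  have h1 := inner_pFlux_le hp X Y
  have h2 := inner_pFlux_le hp Y X
  have h3 := inner_pFlux_self hp X
  have h4 := inner_pFlux_self hp Y
  rw [e] at h3 h4
  simp only [pDefect, inner_sub_left, inner_sub_right]
  linarith

theorem sub_mul_sub_nonneg_rpow {q a b : ℝ} (hq : 0 < q) (ha : 0 ≤ a) (hb : 0 ≤ b) :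
    0 ≤ (a ^ q - b ^ q) * (a - b) := by
  rcases le_total a b with h | h
  · exact mul_nonneg_of_nonpos_of_nonpos
      (sub_nonpos.2 (Real.rpow_le_rpow ha h hq.le)) (sub_nonpos.2 h)
  · exact mul_nonneg (sub_nonneg.2 (Real.rpow_le_rpow hb h hq.le)) (sub_nonneg.2 h)

theorem pDefect_nonneg {p : ℝ} (hp : 1 < p) (X Y : E) : 0 ≤ pDefect p X Y :=
  (sub_mul_sub_nonneg_rpow (by linarith) (norm_nonneg _) (norm_nonneg _)).trans (le_pDefect hp X Y)

theorem eq_of_pDefect_eq_zero {p : ℝ} (hp : 1 < p) {X Y : E} (h : pDefect p X Y = 0) : X = Y := by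
  have hn : ‖X‖ = ‖Y‖ := by
    have h1 : (‖X‖ ^ (p - 1) - ‖Y‖ ^ (p - 1)) * (‖X‖ - ‖Y‖) = 0 :=
      le_antisymm (h ▸ le_pDefect hp X Y)
        (sub_mul_sub_nonneg_rpow (by linarith) (norm_nonneg _) (norm_nonneg _))
    rcases mul_eq_zero.1 h1 with h2 | h2
    · exact (Real.rpow_left_inj (norm_nonneg _) (norm_nonneg _) (by linarith)).1 (sub_eq_zero.1 h2)
    · exact sub_eq_zero.1 h2
  rw [pDefect, pFlux, pFlux, hn, ← smul_sub, real_inner_smul_left, real_inner_self_eq_norm_sq] at h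
  rcases mul_eq_zero.1 h with h1 | h1
  · rw [Real.rpow_eq_zero_iff_of_nonneg (norm_nonneg _)] at h1
    rw [norm_eq_zero.1 h1.1, norm_eq_zero.1 (hn.trans h1.1)]
  · exact sub_eq_zero.1 (norm_eq_zero.1 (pow_eq_zero_iff two_ne_zero |>.1 h1))

/-- Picone-type inequality: with `z = t v`, `r = z / u`, `X = ∇u`, `Y = ∇v`, `W = v ∇t` and
`b = β(r)`, `b' = β'(r)`, the two vectors on the left are the gradients of the test functions
`u r^p β(r)` and `v t^p β(r)`. The error on the right vanishes with the cut-off error `W`. -/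
theorem picone_le {p : ℝ} (hp : 1 < p) {u v t r b b' C : ℝ} (hu : 0 < u)
    (ht0 : 0 ≤ t) (ht1 : t ≤ 1) (hr : r = v * t / u) (hr0 : 0 ≤ r) (hb0 : 0 ≤ b) (hb1 : b ≤ 1)
    (hb'0 : 0 ≤ b') (hb'C : b' ≤ C) (hb' : b' ≠ 0 → 1 ≤ r ∧ r ≤ 2) (X Y W : E) :
    inner ℝ (pFlux p X) ((r ^ p * b) • X +
        (p * r ^ (p - 1) * b + r ^ p * b') • (W + t • Y - r • X)) -
      inner ℝ (pFlux p Y) ((t ^ p * b) • Y + (p * t ^ (p - 1) * b) • W +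
        (v / u * t ^ p * b') • (W + t • Y - r • X)) ≤
    ((2 * p + C) * 2 ^ p) *
        ((‖X‖ ^ (p - 1) + ‖Y‖ ^ (p - 1) + ‖W‖ ^ (p - 1)) * ‖W‖)
      - b' * r * pDefect p (r • X) (t • Y) := by
  have hp0 : 0 < p := by linarith
  have hC0 : 0 ≤ C := hb'0.trans hb'C
  set Z := W + t • Y with hZ
  have hrp : r ^ p = r ^ (p - 1) * r := by
    rcases hr0.eq_or_lt with h | h
    · rw [← h, Real.zero_rpow hp0.ne']; simp
    · rw [← Real.rpow_add_one h.ne']; congr 1; ring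
  have htp : t ^ p = t ^ (p - 1) * t := by
    rcases ht0.eq_or_lt with h | h
    · rw [← h, Real.zero_rpow hp0.ne']; simp
    · rw [← Real.rpow_add_one h.ne']; congr 1; ring
  have hvu : v / u * t ^ p = r * t ^ (p - 1) := by
    rw [htp, hr]; field_simp
  have hsm : ‖t • Y‖ ^ (p - 1) ≤ ‖Y‖ ^ (p - 1) := by
    refine Real.rpow_le_rpow (norm_nonneg _) ?_ (by linarith)
    rw [norm_smul, Real.norm_of_nonneg ht0]
    exact mul_le_of_le_one_left (norm_nonneg _) ht1
  have hZn : ‖Z‖ ^ (p - 1) ≤ 2 ^ (p - 1) * (‖W‖ ^ (p - 1) + ‖Y‖ ^ (p - 1)) := by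
    refine (Real.rpow_le_rpow (norm_nonneg _) (norm_add_le W (t • Y)) (by linarith)).trans ?_
    refine (add_rpow_sub_one_le hp (norm_nonneg _) (norm_nonneg _)).trans ?_
    gcongr
  have h2p : (2 : ℝ) ^ p = 2 ^ (p - 1) * 2 := by
    rw [← Real.rpow_add_one (by norm_num)]; congr 1; ring
  have h2p1 : (1 : ℝ) ≤ 2 ^ (p - 1) := Real.one_le_rpow (by norm_num) (by linarith)
  -- the part that carries `b`
  have hB : r ^ p * inner ℝ (pFlux p X) X + p * r ^ (p - 1) * (inner ℝ (pFlux p X) Z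
        - r * inner ℝ (pFlux p X) X) - (t ^ p * inner ℝ (pFlux p Y) Y
        + p * t ^ (p - 1) * inner ℝ (pFlux p Y) W) ≤
      p * (‖Z‖ ^ (p - 1) + ‖t • Y‖ ^ (p - 1)) * ‖W‖ := by
    have y1 := young_pFlux hp (r • X) Z
    rw [pFlux_smul hp hr0, real_inner_smul_left, norm_smul, Real.norm_of_nonneg hr0,
      Real.mul_rpow hr0 (norm_nonneg _)] at y1
    have y2 := young_pFlux hp Z (t • Y)
    have e2 : inner ℝ (pFlux p Z) (t • Y) = ‖Z‖ ^ p - inner ℝ (pFlux p Z) W := by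
      rw [← inner_pFlux_self hp Z, ← inner_sub_right]
      congr 1
      rw [hZ]; abel
    rw [e2] at y2
    have e3 : ‖t • Y‖ ^ p = t ^ p * ‖Y‖ ^ p := by
      rw [norm_smul, Real.norm_of_nonneg ht0, Real.mul_rpow ht0 (norm_nonneg _)]
    rw [e3] at y2
    have y3 := inner_pFlux_le hp Z W
    have y4 := neg_inner_pFlux_le hp (t • Y) W
    rw [pFlux_smul hp ht0, real_inner_smul_left] at y4
    rw [inner_pFlux_self hp X, inner_pFlux_self hp Y]
    have y5 : r ^ p * ‖X‖ ^ p = r ^ (p - 1) * (r * ‖X‖ ^ p) := by rw [hrp]; ring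
    have y3' := mul_le_mul_of_nonneg_left y3 hp0.le
    have y4' := mul_le_mul_of_nonneg_left y4 hp0.le
    linear_combination y1 + y2 + y3' + y4' + p * y5
  -- the part that carries `b'`
  have hB' : b' * (r ^ p * inner ℝ (pFlux p X) (Z - r • X) -
        r * t ^ (p - 1) * inner ℝ (pFlux p Y) (Z - r • X)) ≤
      C * 2 ^ p * ((‖X‖ ^ (p - 1) + ‖Y‖ ^ (p - 1)) * ‖W‖)
        - b' * r * pDefect p (r • X) (t • Y) := by
    rcases eq_or_ne b' 0 with h0 | h0
    · have : 0 ≤ C := hb'0.trans hb'C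
      rw [h0]
      simp only [zero_mul, sub_zero]
      positivity
    obtain ⟨hr1, hr2⟩ := hb' h0
    have e1 : r ^ p * inner ℝ (pFlux p X) (Z - r • X) -
        r * t ^ (p - 1) * inner ℝ (pFlux p Y) (Z - r • X) =
        r * (inner ℝ (pFlux p (r • X)) W - inner ℝ (pFlux p (t • Y)) W)
          - r * pDefect p (r • X) (t • Y) := by
      have : Z - r • X = W - (r • X - t • Y) := by rw [hZ]; abel
      rw [this, pDefect, hrp, pFlux_smul hp hr0, pFlux_smul hp ht0]
      simp only [inner_sub_left, inner_sub_right, real_inner_smul_left]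
      ring
    have y1 := inner_pFlux_le hp (r • X) W
    have y2 := neg_inner_pFlux_le hp (t • Y) W
    have y3 : ‖r • X‖ ^ (p - 1) ≤ 2 ^ (p - 1) * ‖X‖ ^ (p - 1) := by
      rw [norm_smul, Real.norm_of_nonneg hr0, Real.mul_rpow hr0 (norm_nonneg _)]
      gcongr
    have y4 : ‖t • Y‖ ^ (p - 1) ≤ 2 ^ (p - 1) * ‖Y‖ ^ (p - 1) :=
      hsm.trans (le_mul_of_one_le_left (by positivity) h2p1)
    have y5 : inner ℝ (pFlux p (r • X)) W - inner ℝ (pFlux p (t • Y)) W ≤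
        2 ^ (p - 1) * (‖X‖ ^ (p - 1) + ‖Y‖ ^ (p - 1)) * ‖W‖ := by
      calc _ ≤ (‖r • X‖ ^ (p - 1) + ‖t • Y‖ ^ (p - 1)) * ‖W‖ := by linarith
        _ ≤ (2 ^ (p - 1) * ‖X‖ ^ (p - 1) + 2 ^ (p - 1) * ‖Y‖ ^ (p - 1)) * ‖W‖ := by gcongr
        _ = _ := by ring
    rw [e1, mul_sub, ← mul_assoc b' r (pDefect _ _ _)]
    gcongr ?_ - _
    calc b' * (r * (inner ℝ (pFlux p (r • X)) W - inner ℝ (pFlux p (t • Y)) W))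
        ≤ b' * (r * (2 ^ (p - 1) * (‖X‖ ^ (p - 1) + ‖Y‖ ^ (p - 1)) * ‖W‖)) := by gcongr
      _ ≤ C * (2 * (2 ^ (p - 1) * (‖X‖ ^ (p - 1) + ‖Y‖ ^ (p - 1)) * ‖W‖)) := by gcongr
      _ = _ := by rw [h2p]; ring
  have hBb : p * (‖Z‖ ^ (p - 1) + ‖t • Y‖ ^ (p - 1)) * ‖W‖ ≤
      2 * p * 2 ^ p * ((‖X‖ ^ (p - 1) + ‖Y‖ ^ (p - 1) + ‖W‖ ^ (p - 1)) * ‖W‖) := by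
    have hX' : 0 ≤ ‖X‖ ^ (p - 1) := by positivity
    have hY' : 0 ≤ ‖Y‖ ^ (p - 1) := by positivity
    have hW' : 0 ≤ ‖W‖ ^ (p - 1) := by positivity
    calc p * (‖Z‖ ^ (p - 1) + ‖t • Y‖ ^ (p - 1)) * ‖W‖
        ≤ p * (2 ^ (p - 1) * (‖W‖ ^ (p - 1) + ‖Y‖ ^ (p - 1)) + 2 ^ (p - 1) * ‖Y‖ ^ (p - 1)) * ‖W‖ := by
          gcongr
          exact hsm.trans (le_mul_of_one_le_left hY' h2p1)
      _ = p * 2 ^ (p - 1) * ((2 * ‖Y‖ ^ (p - 1) + ‖W‖ ^ (p - 1)) * ‖W‖) := by ring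
      _ ≤ p * 2 ^ (p - 1) * ((4 * (‖X‖ ^ (p - 1) + ‖Y‖ ^ (p - 1) + ‖W‖ ^ (p - 1))) * ‖W‖) := by
          gcongr; linarith
      _ = _ := by rw [h2p]; ring
  have hBb0 : b * (p * (‖Z‖ ^ (p - 1) + ‖t • Y‖ ^ (p - 1)) * ‖W‖) ≤
      p * (‖Z‖ ^ (p - 1) + ‖t • Y‖ ^ (p - 1)) * ‖W‖ :=
    mul_le_of_le_one_left (by positivity) hb1
  have hC : C * 2 ^ p * ((‖X‖ ^ (p - 1) + ‖Y‖ ^ (p - 1)) * ‖W‖) ≤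
      C * 2 ^ p * ((‖X‖ ^ (p - 1) + ‖Y‖ ^ (p - 1) + ‖W‖ ^ (p - 1)) * ‖W‖) := by
    have hW' : 0 ≤ ‖W‖ ^ (p - 1) := by positivity
    exact mul_le_mul_of_nonneg_left (mul_le_mul_of_nonneg_right (by linarith) (norm_nonneg _))
      (by positivity)
  have hB2 := mul_le_mul_of_nonneg_left hB hb0
  rw [hvu]
  simp only [inner_add_right, real_inner_smul_right, inner_sub_right] at hB' ⊢
  linear_combination hB2 + hBb0 + hBb + hC + hB'

end Flux

/-! ### Calculus of Riemannian gradients -/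

section Gradient

variable {n : ℕ} {M : Type*} [TopologicalSpace M]
  [ChartedSpace (EuclideanSpace ℝ (Fin n)) M] [IsManifold (𝓡 n) ∞ M]
  [RiemannianBundle (fun x : M => TangentSpace (𝓡 n) x)]

/-- `u` is differentiable at `x` with Riemannian gradient `X`. -/
def HasGradAt (u : M → ℝ) (x : M) (X : TangentSpace (𝓡 n) x) : Prop :=
  MDifferentiableAt (𝓡 n) 𝓘(ℝ, ℝ) u x ∧ grad u x = X

theorem grad_eq_of_inner {u : M → ℝ} {x : M} {X : TangentSpace (𝓡 n) x}
    (h : ∀ w : TangentSpace (𝓡 n) x, inner ℝ X w = (mfderiv (𝓡 n) 𝓘(ℝ, ℝ) u x w : ℝ)) :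
    grad u x = X :=
  ext_inner_right ℝ fun w => (inner_grad (n := n) u x w).trans (h w).symm

theorem hasGradAt_grad {u : M → ℝ} (hu : ContMDiff (𝓡 n) 𝓘(ℝ, ℝ) 1 u) (x : M) :
    HasGradAt u x (grad (n := n) u x) :=
  ⟨hu.mdifferentiableAt one_ne_zero, rfl⟩

theorem HasGradAt.of_hasMFDerivAt {u : M → ℝ} {x : M} {X : TangentSpace (𝓡 n) x}
    {d : TangentSpace (𝓡 n) x →L[ℝ] ℝ} (h : HasMFDerivAt (𝓡 n) 𝓘(ℝ, ℝ) u x d)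
    (hX : ∀ w : TangentSpace (𝓡 n) x, inner ℝ X w = d w) : HasGradAt u x X :=
  ⟨h.mdifferentiableAt, grad_eq_of_inner fun w => by rw [hX, h.mfderiv]; rfl⟩

theorem HasGradAt.mul {u v : M → ℝ} {x : M} {X Y : TangentSpace (𝓡 n) x}
    (hu : HasGradAt u x X) (hv : HasGradAt v x Y) :
    HasGradAt (fun y => u y * v y) x (u x • Y + v x • X) := by
  refine .of_hasMFDerivAt (HasMFDerivAt.mul hu.1.hasMFDerivAt hv.1.hasMFDerivAt) fun w => ?_
  rw [← hu.2, ← hv.2, inner_add_left, real_inner_smul_left, real_inner_smul_left, inner_grad,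
    inner_grad]
  rfl

theorem HasGradAt.add {u v : M → ℝ} {x : M} {X Y : TangentSpace (𝓡 n) x}
    (hu : HasGradAt u x X) (hv : HasGradAt v x Y) :
    HasGradAt (fun y => u y + v y) x (X + Y) := by
  refine .of_hasMFDerivAt (HasMFDerivAt.add hu.1.hasMFDerivAt hv.1.hasMFDerivAt) fun w => ?_
  rw [← hu.2, ← hv.2, inner_add_left, inner_grad, inner_grad]
  rfl

theorem HasGradAt.sub {u v : M → ℝ} {x : M} {X Y : TangentSpace (𝓡 n) x}
    (hu : HasGradAt u x X) (hv : HasGradAt v x Y) :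
    HasGradAt (fun y => u y - v y) x (X - Y) := by
  refine .of_hasMFDerivAt (HasMFDerivAt.sub hu.1.hasMFDerivAt hv.1.hasMFDerivAt) fun w => ?_
  rw [← hu.2, ← hv.2, inner_sub_left, inner_grad, inner_grad]
  rfl

/-- Chain rule. -/
theorem HasGradAt.comp_real {u : M → ℝ} {x : M} {X : TangentSpace (𝓡 n) x} {F : ℝ → ℝ} {F' : ℝ}
    (hF : HasDerivAt F F' (u x)) (hu : HasGradAt u x X) :
    HasGradAt (fun y => F (u y)) x (F' • X) := by
  refine .of_hasMFDerivAt (HasMFDerivAt.comp x hF.hasFDerivAt.hasMFDerivAt hu.1.hasMFDerivAt)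
    fun w => ?_
  rw [← hu.2, real_inner_smul_left, inner_grad]
  exact mul_comm _ _

theorem HasGradAt.div {u v : M → ℝ} {x : M} {X Y : TangentSpace (𝓡 n) x}
    (hu : HasGradAt u x X) (hv : HasGradAt v x Y) (h0 : v x ≠ 0) :
    HasGradAt (fun y => u y / v y) x ((v x)⁻¹ • (X - (u x / v x) • Y)) := by
  have h := hu.mul (HasGradAt.comp_real (hasDerivAt_inv h0) hv)
  simp only [← div_eq_mul_inv] at h
  convert h using 1
  rw [smul_sub, smul_smul, smul_smul, sub_eq_neg_add, ← neg_smul]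
  congr 2
  field_simp

theorem grad_eq_zero_of_eventuallyEq {u : M → ℝ} {x : M} (h : u =ᶠ[𝓝 x] fun _ => 0) :
    grad (n := n) u x = 0 :=
  grad_eq_of_inner fun w => by
    rw [h.mfderiv_eq, mfderiv_const, inner_zero_left]
    rfl

theorem grad_eq_zero_of_notMem_tsupport {u : M → ℝ} {x : M} (h : x ∉ tsupport u) :
    grad (n := n) u x = 0 :=
  grad_eq_zero_of_eventuallyEq (notMem_tsupport_iff_eventuallyEq.1 h)

end Gradient

/-! ### Continuity of the gradient field -/

section Continuity

variable {n : ℕ} {M : Type*} [TopologicalSpace M]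
  [ChartedSpace (EuclideanSpace ℝ (Fin n)) M] [IsManifold (𝓡 n) ∞ M]
  [RiemannianBundle (fun x : M => TangentSpace (𝓡 n) x)]
  [IsContMDiffRiemannianBundle (𝓡 n) ∞ (EuclideanSpace ℝ (Fin n))
      (fun x : M => TangentSpace (𝓡 n) x)]

theorem isContinuousRiemannianBundle_tangent (n : ℕ) (M : Type*) [TopologicalSpace M]
    [ChartedSpace (EuclideanSpace ℝ (Fin n)) M] [IsManifold (𝓡 n) ∞ M]
    [RiemannianBundle (fun x : M => TangentSpace (𝓡 n) x)]
    [h : IsContMDiffRiemannianBundle (𝓡 n) ∞ (EuclideanSpace ℝ (Fin n))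
      (fun x : M => TangentSpace (𝓡 n) x)] :
    IsContinuousRiemannianBundle (EuclideanSpace ℝ (Fin n))
      (fun x : M => TangentSpace (𝓡 n) x) := by
  obtain ⟨g, hg, hg'⟩ := h.exists_contMDiff
  exact ⟨g, hg.continuous, hg'⟩

theorem continuousAt_inner_grad_section {u : M → ℝ} (hu : ContMDiff (𝓡 n) 𝓘(ℝ, ℝ) 1 u)
    {X : Π x : M, TangentSpace (𝓡 n) x} {x₀ : M}
    (hX : ContinuousAt (fun x => (⟨x, X x⟩ : TangentBundle (𝓡 n) M)) x₀) :
    ContinuousAt (fun x => inner ℝ (grad u x) (X x)) x₀ := by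
  simp only [inner_grad]
  have h1 := (hu.continuous_tangentMap le_rfl).continuousAt.comp hX
  have h2 := (contMDiff_snd_tangentBundle_modelSpace (n := 1) ℝ 𝓘(ℝ, ℝ)).continuous
  exact h2.continuousAt.comp h1

/-- The gradient of a `C¹` function is a continuous vector field. -/
theorem continuous_grad {u : M → ℝ} (hu : ContMDiff (𝓡 n) 𝓘(ℝ, ℝ) 1 u) :
    Continuous (fun x => (⟨x, grad u x⟩ : TangentBundle (𝓡 n) M)) := by
  have := isContinuousRiemannianBundle_tangent n M
  rw [continuous_iff_continuousAt]
  intro x₀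
  set E := EuclideanSpace ℝ (Fin n)
  set e := trivializationAt E (TangentSpace (𝓡 n) (M := M)) x₀ with he
  have hx₀ : x₀ ∈ e.baseSet := FiberBundle.mem_baseSet_trivializationAt' x₀
  -- the vector fields with constant coordinates in the trivialization at `x₀`
  let s : E → Π x : M, TangentSpace (𝓡 n) x := fun w x => e.symmL ℝ x w
  have hs : ∀ w, ContinuousAt (fun x => (⟨x, s w x⟩ : TangentBundle (𝓡 n) M)) x₀ := by
    intro w
    rw [FiberBundle.continuousAt_totalSpace]
    refine ⟨continuousAt_id, ?_⟩
    refine (continuousAt_const (y := w)).congr ?_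
    filter_upwards [e.open_baseSet.mem_nhds hx₀] with x hx
    have := e.continuousLinearMapAt_symmL (R := ℝ) hx w
    rw [e.continuousLinearMapAt_apply ℝ, e.coe_linearMapAt_of_mem (R := ℝ) hx] at this
    exact this.symm
  let w₀ : E := e.continuousLinearMapAt ℝ x₀ (grad u x₀)
  let D : Π x : M, TangentSpace (𝓡 n) x := fun x => grad u x - s w₀ x
  have hD0 : D x₀ = 0 := by
    simp only [D, s, w₀]
    rw [e.symmL_continuousLinearMapAt hx₀, sub_self]
  have hDs : ∀ w, Tendsto (fun x => inner ℝ (D x) (s w x)) (𝓝 x₀) (𝓝 0) := by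
    intro w
    have h1 : ContinuousAt (fun x => inner ℝ (grad u x) (s w x) - inner ℝ (s w₀ x) (s w x)) x₀ :=
      (continuousAt_inner_grad_section hu (hs w)).sub ((hs w₀).inner_bundle (hs w))
    have h2 : (fun x => inner ℝ (D x) (s w x)) = fun x =>
        inner ℝ (grad u x) (s w x) - inner ℝ (s w₀ x) (s w x) := by
      funext x
      simp only [D]
      rw [inner_sub_left]
    have h3 : inner ℝ (D x₀) (s w x₀) = 0 := by rw [hD0, inner_zero_left]
    rw [← h3]
    exact (h2 ▸ h1 : ContinuousAt (fun x => inner ℝ (D x) (s w x)) x₀)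
  obtain ⟨C, hC, hCe⟩ := eventually_norm_trivializationAt_lt E (TangentSpace (𝓡 n) (M := M)) x₀
  have hDle : ∀ᶠ x in 𝓝 x₀, ‖D x‖ ≤
      C * ∑ i : Fin n, |inner ℝ (D x) (s (EuclideanSpace.single i 1) x)| := by
    filter_upwards [hCe, e.open_baseSet.mem_nhds hx₀] with x hx hxe
    set c : E := e.continuousLinearMapAt ℝ x (D x) with hc
    have hcn : ‖c‖ ≤ C * ‖D x‖ := (ContinuousLinearMap.le_opNorm _ _).trans (by gcongr)
    have hci : ∀ i, |c i| ≤ C * ‖D x‖ := fun i => (PiLp.norm_apply_le c i).trans hcn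
    have hDc : D x = ∑ i : Fin n, c i • s (EuclideanSpace.single i 1) x := by
      have h1 : D x = e.symmL ℝ x c := (e.symmL_continuousLinearMapAt hxe _).symm
      have h2 : c = ∑ i : Fin n, c i • EuclideanSpace.single i (1 : ℝ) := by
        ext j
        simp [Finset.sum_apply, Pi.single_apply]
      rw [h1]
      conv_lhs => rw [h2]
      rw [map_sum]
      simp only [map_smul, s]
    have h3 : ‖D x‖ * ‖D x‖ ≤
        (C * ∑ i : Fin n, |inner ℝ (D x) (s (EuclideanSpace.single i 1) x)|) * ‖D x‖ := by
      rw [← real_inner_self_eq_norm_mul_norm]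
      nth_rw 2 [hDc]
      rw [inner_sum, Finset.mul_sum, Finset.sum_mul]
      refine Finset.sum_le_sum fun i _ => ?_
      rw [real_inner_smul_right]
      refine (le_abs_self _).trans ?_
      rw [abs_mul]
      calc _ ≤ C * ‖D x‖ * _ := mul_le_mul_of_nonneg_right (hci i) (abs_nonneg _)
        _ = _ := by ring
    rcases (norm_nonneg (D x)).eq_or_lt with h0 | h0
    · rw [← h0]; positivity
    · exact le_of_mul_le_mul_right h3 h0
  have hDt : Tendsto (fun x => ‖D x‖) (𝓝 x₀) (𝓝 0) := by
    refine squeeze_zero' (.of_forall fun x => norm_nonneg _) hDle ?_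
    have : Tendsto (fun x => C * ∑ i : Fin n, |inner ℝ (D x) (s (EuclideanSpace.single i 1) x)|)
        (𝓝 x₀) (𝓝 (C * ∑ i : Fin n, |(0 : ℝ)|)) :=
      (tendsto_finsetSum _ fun i _ => (hDs _).abs).const_mul C
    simpa using this
  rw [FiberBundle.continuousAt_totalSpace]
  refine ⟨continuousAt_id, ?_⟩
  have h5 : Tendsto (fun x => e.continuousLinearMapAt ℝ x (D x)) (𝓝 x₀) (𝓝 0) := by
    refine squeeze_zero_norm' (a := fun x => C * ‖D x‖) ?_ (by simpa using hDt.const_mul C)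
    filter_upwards [hCe] with x hx
    exact (ContinuousLinearMap.le_opNorm _ _).trans (by gcongr)
  have h6 : Tendsto (fun x => e.continuousLinearMapAt ℝ x (D x) + w₀) (𝓝 x₀) (𝓝 w₀) := by
    simpa using h5.add_const w₀
  have h7 : (fun x => e.continuousLinearMapAt ℝ x (D x) + w₀) =ᶠ[𝓝 x₀]
      fun x => (e (⟨x, grad u x⟩ : TangentBundle (𝓡 n) M)).2 := by
    filter_upwards [e.open_baseSet.mem_nhds hx₀] with x hxe
    simp only [D, s]
    rw [map_sub, e.continuousLinearMapAt_symmL hxe, sub_add_cancel,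
      e.continuousLinearMapAt_apply ℝ, e.coe_linearMapAt_of_mem (R := ℝ) hxe]
  have h8 : Tendsto (fun x => (e (⟨x, grad u x⟩ : TangentBundle (𝓡 n) M)).2) (𝓝 x₀) (𝓝 w₀) :=
    h6.congr' h7
  have h9 : w₀ = (e (⟨x₀, grad u x₀⟩ : TangentBundle (𝓡 n) M)).2 := by
    simp only [w₀]
    rw [e.continuousLinearMapAt_apply ℝ, e.coe_linearMapAt_of_mem (R := ℝ) hx₀]
  rw [h9] at h8
  exact h8

theorem continuous_inner_grad {u v : M → ℝ} (hu : ContMDiff (𝓡 n) 𝓘(ℝ, ℝ) 1 u)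
    (hv : ContMDiff (𝓡 n) 𝓘(ℝ, ℝ) 1 v) :
    Continuous (fun x => inner ℝ (grad (n := n) u x) (grad (n := n) v x)) :=
  have := isContinuousRiemannianBundle_tangent n M
  (continuous_grad hu).inner_bundle (continuous_grad hv)

theorem continuous_norm_grad {u : M → ℝ} (hu : ContMDiff (𝓡 n) 𝓘(ℝ, ℝ) 1 u) :
    Continuous (fun x => ‖grad (n := n) u x‖) := by
  have h := (continuous_inner_grad hu hu).sqrt
  simpa only [real_inner_self_eq_norm_sq, Real.sqrt_sq (norm_nonneg _)] using h

/-- The flux `|∇u|^{p-2} ∇u` pairs continuously with gradients; at the zeros of `∇u`, where the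
factor `|∇u|^{p-2}` may be discontinuous, this uses `p > 1`. -/
theorem continuous_inner_pFlux_grad {p : ℝ} (hp : 1 < p) {u : M → ℝ}
    (hu : ContMDiff (𝓡 n) 𝓘(ℝ, ℝ) 1 u) {X : Π x : M, TangentSpace (𝓡 n) x}
    (hX : Continuous (fun x => (⟨x, X x⟩ : TangentBundle (𝓡 n) M))) :
    Continuous (fun x => inner ℝ (pFlux p (grad (n := n) u x)) (X x)) := by
  have := isContinuousRiemannianBundle_tangent n M
  have hXX : Continuous fun x => ‖X x‖ := by
    have h := (hX.inner_bundle hX).sqrt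
    simpa only [real_inner_self_eq_norm_sq, Real.sqrt_sq (norm_nonneg _)] using h
  rw [continuous_iff_continuousAt]
  intro x₀
  rcases eq_or_ne (grad (n := n) u x₀) 0 with h0 | h0
  · have h1 : inner ℝ (pFlux p (grad (n := n) u x₀)) (X x₀) = 0 := by
      rw [h0, pFlux, smul_zero, inner_zero_left]
    rw [ContinuousAt, h1]
    have hb : Continuous fun x => ‖grad (n := n) u x‖ ^ (p - 1) * ‖X x‖ :=
      ((continuous_norm_grad hu).rpow_const fun x => Or.inr (by linarith)).mul hXX
    have hb0 : ‖grad (n := n) u x₀‖ ^ (p - 1) * ‖X x₀‖ = 0 := by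
      rw [h0, norm_zero, Real.zero_rpow (by linarith : p - 1 ≠ 0), zero_mul]
    refine squeeze_zero_norm (a := fun x => ‖grad (n := n) u x‖ ^ (p - 1) * ‖X x‖) (fun x => ?_)
      (hb0 ▸ hb.continuousAt)
    rw [← norm_pFlux hp]
    exact abs_real_inner_le_norm _ _
  · simp only [pFlux, real_inner_smul_left]
    exact (((continuous_norm_grad hu).continuousAt).rpow_const
      (Or.inl (norm_ne_zero_iff.2 h0))).mul ((continuous_grad hu).inner_bundle hX).continuousAt

end Continuity

/-! ### The Riemannian measure -/

section Volume

variable {n : ℕ} {M : Type*} [TopologicalSpace M]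
  [ChartedSpace (EuclideanSpace ℝ (Fin n)) M] [IsManifold (𝓡 n) ∞ M]
  [RiemannianBundle (fun x : M => TangentSpace (𝓡 n) x)]

theorem volDensity_pos {c : M} {y : EuclideanSpace ℝ (Fin n)}
    (hy : y ∈ (chartAt (EuclideanSpace ℝ (Fin n)) c).target) : 0 < volDensity (n := n) c y := by
  rw [volDensity, Real.sqrt_pos]
  have hinj := (mdifferentiable_chart (I := 𝓡 n) c).symm.mfderiv_injective hy
  have hli : LinearIndependent ℝ (fun i => coordVec (n := n) c y i) := by
    have h0 : LinearIndependent ℝ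
        (fun i : Fin n => (EuclideanSpace.single i (1 : ℝ) : EuclideanSpace ℝ (Fin n))) := by
      have e : (fun i : Fin n => (EuclideanSpace.single i (1 : ℝ) : EuclideanSpace ℝ (Fin n))) =
          (EuclideanSpace.basisFun (Fin n) ℝ).toBasis := by
        funext i; simp
      rw [e]
      exact (EuclideanSpace.basisFun (Fin n) ℝ).toBasis.linearIndependent
    exact h0.map' (mfderiv (𝓡 n) (𝓡 n)
      (chartAt (EuclideanSpace ℝ (Fin n)) c).symm y).toLinearMap (LinearMap.ker_eq_bot.2 hinj)
  exact (Matrix.posDef_gram_of_linearIndependent (𝕜 := ℝ) hli).det_pos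

variable [IsContMDiffRiemannianBundle (𝓡 n) ∞ (EuclideanSpace ℝ (Fin n))
      (fun x : M => TangentSpace (𝓡 n) x)]

theorem continuousOn_coordVec (c : M) (i : Fin n) :
    ContinuousOn (fun y => (⟨(chartAt (EuclideanSpace ℝ (Fin n)) c).symm y, coordVec c y i⟩ :
      TangentBundle (𝓡 n) M)) (chartAt (EuclideanSpace ℝ (Fin n)) c).target := by
  set φ := chartAt (EuclideanSpace ℝ (Fin n)) c
  have h1 : ContMDiffOn (𝓡 n) (𝓡 n) ∞ φ.symm φ.target := contMDiffOn_chart_symm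
  have h2 := h1.continuousOn_tangentMapWithin (by simp) φ.open_target.uniqueMDiffOn
  have h3 : Continuous (fun y : EuclideanSpace ℝ (Fin n) =>
      (⟨y, (EuclideanSpace.single i (1 : ℝ) : EuclideanSpace ℝ (Fin n))⟩ :
        TangentBundle (𝓡 n) (EuclideanSpace ℝ (Fin n)))) :=
    (tangentBundleModelSpaceHomeomorph (𝓡 n)).symm.continuous.comp
      (continuous_id.prodMk continuous_const)
  refine (h2.comp h3.continuousOn fun y hy => hy).congr fun y hy => ?_
  simp only [Function.comp, tangentMapWithin, coordVec]
  rw [mfderivWithin_of_isOpen φ.open_target hy]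

theorem continuousOn_volDensity (c : M) :
    ContinuousOn (volDensity (n := n) c) (chartAt (EuclideanSpace ℝ (Fin n)) c).target := by
  have := isContinuousRiemannianBundle_tangent n M
  refine ContinuousOn.sqrt ?_
  simp only [Matrix.det_apply, Matrix.of_apply]
  refine continuousOn_finsetSum _ fun σ _ => ContinuousOn.const_smul ?_ _
  exact continuousOn_finsetProd _ fun i _ =>
    (continuousOn_coordVec c _).inner_bundle (continuousOn_coordVec c _)

variable [T2Space M] [SigmaCompactSpace M] [MeasurableSpace M] [BorelSpace M]

theorem map_chart_symm_apply (c : M) {A : Set M} (hA : MeasurableSet A) :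
    Measure.map (chartAt (EuclideanSpace ℝ (Fin n)) c).symm
      ((volume.restrict (chartAt (EuclideanSpace ℝ (Fin n)) c).target).withDensity
        fun y => ENNReal.ofReal (volDensity c y)) A =
      ∫⁻ y in (chartAt (EuclideanSpace ℝ (Fin n)) c).target ∩
        (chartAt (EuclideanSpace ℝ (Fin n)) c).symm ⁻¹' A, ENNReal.ofReal (volDensity c y) := by
  set φ := chartAt (EuclideanSpace ℝ (Fin n)) c
  have hm : AEMeasurable φ.symm ((volume.restrict φ.target).withDensity
        fun y => ENNReal.ofReal (volDensity c y)) :=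
    (φ.continuousOn_symm.aemeasurable φ.open_target.measurableSet).mono_ac
      (withDensity_absolutelyContinuous _ _)
  rw [Measure.map_apply_of_aemeasurable hm hA, withDensity_apply', Measure.restrict_restrict₀',
    inter_comm]
  exact φ.open_target.measurableSet.nullMeasurableSet

theorem support_chartPartition_subset (c : M) :
    tsupport (chartPartition n M c) ⊆ (chartAt (EuclideanSpace ℝ (Fin n)) c).source :=
  chartPartition_isSubordinate n M c

theorem isFiniteMeasureOnCompacts_riemVol : IsFiniteMeasureOnCompacts (riemVol n M) := by
  refine ⟨fun K hK => ?_⟩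
  rw [riemVol, Measure.sum_apply _ hK.measurableSet]
  have hfin : {c : M | ((Function.support (chartPartition n M c)) ∩ K).Nonempty}.Finite :=
    (chartPartition n M).locallyFinite.finite_nonempty_inter_compact hK
  rw [tsum_eq_sum (s := hfin.toFinset)]
  · refine ENNReal.sum_lt_top.2 fun c _ => ?_
    set φ := chartAt (EuclideanSpace ℝ (Fin n)) c
    set K' := K ∩ tsupport (chartPartition n M c) with hK'
    have hK'c : IsCompact K' := hK.inter_right (isClosed_tsupport _)
    have hK's : K' ⊆ φ.source := inter_subset_right.trans (support_chartPartition_subset c)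
    rw [withDensity_apply _ hK.measurableSet]
    have hle : ∀ x ∈ K, ENNReal.ofReal (chartPartition n M c x) ≤
        K'.indicator (fun _ => (1 : ℝ≥0∞)) x := by
      intro x hx
      by_cases hx' : x ∈ tsupport (chartPartition n M c)
      · rw [indicator_of_mem (show x ∈ K' from ⟨hx, hx'⟩)]
        exact ENNReal.ofReal_le_one.2 ((chartPartition n M).le_one c x)
      · rw [image_eq_zero_of_notMem_tsupport hx']; simp
    refine (setLIntegral_mono' hK.measurableSet hle).trans_lt ?_
    refine (setLIntegral_le_lintegral _ _).trans_lt ?_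
    rw [lintegral_indicator_const hK'c.measurableSet, one_mul,
      map_chart_symm_apply c hK'c.measurableSet]
    have himg : φ.target ∩ φ.symm ⁻¹' K' = φ '' K' :=
      (φ.image_eq_target_inter_inv_preimage hK's).symm
    rw [himg]
    have hc : IsCompact (φ '' K') := hK'c.image_of_continuousOn (φ.continuousOn.mono hK's)
    have hct : φ '' K' ⊆ φ.target := himg ▸ inter_subset_left
    obtain ⟨C, hC⟩ := hc.bddAbove_image ((continuousOn_volDensity c).mono hct)
    refine (setLIntegral_mono' (g := fun _ => ENNReal.ofReal C) hc.measurableSet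
      fun y hy => ENNReal.ofReal_le_ofReal (hC (mem_image_of_mem _ hy))).trans_lt ?_
    rw [setLIntegral_const]
    exact ENNReal.mul_lt_top ENNReal.ofReal_lt_top hc.measure_lt_top
  · intro c hc
    rw [withDensity_apply _ hK.measurableSet]
    refine setLIntegral_eq_zero hK.measurableSet fun x hx => ?_
    have : x ∉ Function.support (chartPartition n M c) := fun h =>
      hc (hfin.mem_toFinset.2 ⟨x, h, hx⟩)
    rw [Function.notMem_support.1 this]; simp

theorem isOpenPosMeasure_riemVol : (riemVol n M).IsOpenPosMeasure := by
  refine ⟨fun U hU hne h0 => ?_⟩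
  obtain ⟨x, hx⟩ := hne
  obtain ⟨c, hc⟩ := (chartPartition n M).exists_pos_of_mem (mem_univ x)
  rw [riemVol, Measure.sum_apply _ hU.measurableSet, ENNReal.tsum_eq_zero] at h0
  have h1 := h0 c
  set φ := chartAt (EuclideanSpace ℝ (Fin n)) c
  have hηc : Continuous (chartPartition n M c) := (chartPartition n M c).contMDiff.continuous
  set V := {y | 0 < chartPartition n M c y} ∩ U with hV
  have hVo : IsOpen V := (isOpen_lt continuous_const hηc).inter hU
  have hVs : V ⊆ φ.source := fun y hy => support_chartPartition_subset c
    (subset_tsupport _ (ne_of_gt (show 0 < chartPartition n M c y from hy.1)))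
  rw [withDensity_apply_eq_zero (hηc.measurable.ennreal_ofReal)] at h1
  have hset : {y | ENNReal.ofReal (chartPartition n M c y) ≠ 0} ∩ U = V := by
    ext y; simp [hV]
  rw [hset, map_chart_symm_apply c hVo.measurableSet] at h1
  have hWo : IsOpen (φ.target ∩ φ.symm ⁻¹' V) :=
    φ.symm.isOpen_inter_preimage hVo
  have hdm : AEMeasurable (fun y => ENNReal.ofReal (volDensity (n := n) c y))
      (volume.restrict (φ.target ∩ φ.symm ⁻¹' V)) :=
    (((continuousOn_volDensity c).mono inter_subset_left).aemeasurable
      hWo.measurableSet).ennreal_ofReal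
  rw [setLIntegral_eq_zero_iff' hWo.measurableSet hdm] at h1
  have h2 : volume (φ.target ∩ φ.symm ⁻¹' V) = 0 := by
    rw [measure_eq_zero_iff_ae_notMem]
    filter_upwards [h1] with y h hy
    exact (ENNReal.ofReal_pos.2 (volDensity_pos hy.1)).ne' (h hy)
  rw [hWo.measure_eq_zero_iff volume] at h2
  have h3 : φ x ∈ φ.target ∩ φ.symm ⁻¹' V := by
    have hxV : x ∈ V := ⟨hc, hx⟩
    refine ⟨φ.map_source (hVs hxV), ?_⟩
    rw [mem_preimage, φ.left_inv (hVs hxV)]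
    exact hxV
  rw [h2] at h3
  exact h3

end Volume

/-! ### Mollification -/

section Mollify

/-- Mollification in a Euclidean space: a compactly supported `C¹` function is a `C¹`-uniform
limit of smooth functions supported in a fixed compact subset of any neighbourhood of its
support. -/
theorem exists_mollify {E : Type*} [NormedAddCommGroup E] [InnerProductSpace ℝ E]
    [FiniteDimensional ℝ E] {g : E → ℝ} {K U : Set E} (hg : ContDiff ℝ 1 g)
    (hK : IsCompact K) (hgK : tsupport g ⊆ K) (hg0 : ∀ y, 0 ≤ g y) (hU : IsOpen U) (hKU : K ⊆ U) :
    ∃ K' : Set E, IsCompact K' ∧ K' ⊆ U ∧ K ⊆ K' ∧ ∀ ε : ℝ, 0 < ε → ∃ q : E → ℝ,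
      ContDiff ℝ ∞ q ∧ tsupport q ⊆ K' ∧ (∀ y, 0 ≤ q y) ∧ (∀ y, |q y - g y| ≤ ε) ∧
      ∀ y, ‖fderiv ℝ q y - fderiv ℝ g y‖ ≤ ε := by
  borelize E
  have hgc : HasCompactSupport g := hK.of_isClosed_subset (isClosed_tsupport g) hgK
  obtain ⟨δ₀, hδ₀, hδU⟩ := hK.exists_cthickening_subset_open hU hKU
  refine ⟨Metric.cthickening δ₀ K, hK.cthickening, hδU, Metric.self_subset_cthickening K,
    fun ε hε => ?_⟩
  have hu := hgc.uniformContinuous_of_continuous hg.continuous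
  have hu' := (hgc.fderiv ℝ).uniformContinuous_of_continuous (hg.continuous_fderiv one_ne_zero)
  obtain ⟨δ₁, hδ₁, h1⟩ := Metric.uniformContinuous_iff.1 hu ε hε
  obtain ⟨δ₂, hδ₂, h2⟩ := Metric.uniformContinuous_iff.1 hu' ε hε
  set δ := min δ₀ (min δ₁ δ₂) with hδdef
  have hδ : 0 < δ := lt_min hδ₀ (lt_min hδ₁ hδ₂)
  let φ : ContDiffBump (0 : E) := ⟨δ / 2, δ, by positivity, by linarith⟩
  set q := convolution (φ.normed volume) g (ContinuousLinearMap.lsmul ℝ ℝ) volume with hq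
  have hderiv : ∀ y, HasFDerivAt q (convolution (φ.normed volume) (fderiv ℝ g)
      (ContinuousLinearMap.lsmul ℝ ℝ) volume y) y := fun y =>
    hgc.hasFDerivAt_convolution_right (ContinuousLinearMap.lsmul ℝ ℝ)
      φ.integrable_normed.locallyIntegrable hg y
  refine ⟨q, ?_, ?_, ?_, ?_, ?_⟩
  · exact φ.hasCompactSupport_normed.contDiff_convolution_left _ φ.contDiff_normed
      hg.continuous.locallyIntegrable
  · refine closure_minimal (fun y hy => ?_) Metric.isClosed_cthickening
    by_contra hyn
    refine hy ?_
    have hz : ∀ x ∈ Metric.closedBall y δ, g x = 0 := fun x hx => by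
      by_contra hx0
      refine hyn (Metric.mem_cthickening_of_dist_le y x δ₀ K (hgK (subset_tsupport g hx0)) ?_)
      rw [dist_comm]
      exact (Metric.mem_closedBall.1 hx).trans (min_le_left _ _)
    have h3 := φ.dist_normed_convolution_le (μ := volume) (x₀ := y) (ε := 0)
      hg.continuous.aestronglyMeasurable (fun x hx => by
        rw [hz x (Metric.ball_subset_closedBall hx), hz y (Metric.mem_closedBall_self hδ.le),
          dist_self])
    rw [dist_le_zero, hz y (Metric.mem_closedBall_self hδ.le)] at h3
    exact h3
  · intro y
    refine integral_nonneg fun t => ?_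
    exact mul_nonneg (φ.nonneg_normed t) (hg0 _)
  · intro y
    have h3 := φ.dist_normed_convolution_le (μ := volume) (x₀ := y) (ε := ε)
      hg.continuous.aestronglyMeasurable (fun x hx =>
        (h1 ((Metric.mem_ball.1 hx).trans_le ((min_le_right _ _).trans (min_le_left _ _)))).le)
    rwa [Real.dist_eq] at h3
  · intro y
    have h3 := φ.dist_normed_convolution_le (μ := volume) (x₀ := y) (ε := ε)
      (hg.continuous_fderiv one_ne_zero).aestronglyMeasurable (fun x hx =>
        (h2 ((Metric.mem_ball.1 hx).trans_le ((min_le_right _ _).trans (min_le_right _ _)))).le)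
    rwa [(hderiv y).fderiv, ← dist_eq_norm]

theorem tsupport_indicator_comp_symm_subset {X Y : Type*} [TopologicalSpace X]
    [TopologicalSpace Y] [T2Space Y] (e : OpenPartialHomeomorph X Y) {f : X → ℝ} {K : Set X}
    (hK : IsCompact K) (hKs : K ⊆ e.source) (hf : tsupport f ⊆ K) :
    tsupport (e.target.indicator (f ∘ e.symm)) ⊆ e '' K := by
  refine closure_minimal (fun y hy => ?_)
    (hK.image_of_continuousOn (e.continuousOn.mono hKs)).isClosed
  have hyt : y ∈ e.target := by
    by_contra h
    exact hy (indicator_of_notMem h _)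
  refine ⟨e.symm y, hf (subset_tsupport f fun h0 => hy ?_), e.right_inv hyt⟩
  rw [indicator_of_mem hyt]
  exact h0

end Mollify

/-! ### Approximation of compactly supported C¹ functions -/

section ChartApprox

variable {n : ℕ} {M : Type*} [TopologicalSpace M]
  [ChartedSpace (EuclideanSpace ℝ (Fin n)) M] [IsManifold (𝓡 n) ∞ M]
  [RiemannianBundle (fun x : M => TangentSpace (𝓡 n) x)]

/-- `T` is a nonnegative function that is a `C¹`-uniform limit of nonnegative smooth functions
supported in a common compact set. -/
def SmoothlyApproximable (n : ℕ) {M : Type*} [TopologicalSpace M]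
    [ChartedSpace (EuclideanSpace ℝ (Fin n)) M]
    [IsManifold (𝓡 n) ∞ M] [RiemannianBundle (fun x : M => TangentSpace (𝓡 n) x)]
    (T : M → ℝ) : Prop :=
  ∃ K : Set M, IsCompact K ∧ tsupport T ⊆ K ∧ ∀ ε : ℝ, 0 < ε → ∃ ψ : M → ℝ,
    ContMDiff (𝓡 n) 𝓘(ℝ, ℝ) ∞ ψ ∧ tsupport ψ ⊆ K ∧ (∀ x, 0 ≤ ψ x) ∧ (∀ x, |ψ x - T x| ≤ ε) ∧
    ∀ x, ‖grad (n := n) ψ x - grad (n := n) T x‖ ≤ ε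

theorem smoothlyApproximable_zero : SmoothlyApproximable n (fun _ : M => (0 : ℝ)) := by
  refine ⟨∅, isCompact_empty, ?_, fun ε hε => ⟨fun _ => 0, contMDiff_const, ?_, fun _ => le_rfl,
    fun x => ?_, fun x => ?_⟩⟩
  · simp [tsupport, Function.support]
  · simp [tsupport, Function.support]
  · simpa using hε.le
  · simpa using hε.le

theorem SmoothlyApproximable.add {T S : M → ℝ} (hT : SmoothlyApproximable n T)
    (hS : SmoothlyApproximable n S) (hT1 : ContMDiff (𝓡 n) 𝓘(ℝ, ℝ) 1 T)
    (hS1 : ContMDiff (𝓡 n) 𝓘(ℝ, ℝ) 1 S) : SmoothlyApproximable n (fun x => T x + S x) := by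
  obtain ⟨K, hK, hTK, h⟩ := hT
  obtain ⟨L, hL, hSL, h'⟩ := hS
  refine ⟨K ∪ L, hK.union hL, (tsupport_add T S).trans (union_subset_union hTK hSL),
    fun ε hε => ?_⟩
  obtain ⟨ψ, h1, h2, h3, h4, h5⟩ := h (ε / 2) (by positivity)
  obtain ⟨χ, k1, k2, k3, k4, k5⟩ := h' (ε / 2) (by positivity)
  refine ⟨fun x => ψ x + χ x, h1.add k1, (tsupport_add ψ χ).trans (union_subset_union h2 k2),
    fun x => add_nonneg (h3 x) (k3 x), fun x => ?_, fun x => ?_⟩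
  · calc |ψ x + χ x - (T x + S x)| = |(ψ x - T x) + (χ x - S x)| := by ring_nf
      _ ≤ |ψ x - T x| + |χ x - S x| := abs_add_le _ _
      _ ≤ ε := by linarith [h4 x, k4 x]
  · rw [((hasGradAt_grad (h1.of_le (by simp)) x).add (hasGradAt_grad (k1.of_le (by simp)) x)).2,
      ((hasGradAt_grad hT1 x).add (hasGradAt_grad hS1 x)).2, add_sub_add_comm]
    refine (norm_add_le _ _).trans ?_
    linarith [h5 x, k5 x]

variable [IsContMDiffRiemannianBundle (𝓡 n) ∞ (EuclideanSpace ℝ (Fin n))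
      (fun x : M => TangentSpace (𝓡 n) x)]

/-- Near its centre, a chart has bounded derivative from the Riemannian norm to the Euclidean
one. -/
theorem exists_norm_mfderiv_chart_le (c : M) : ∃ (C : ℝ) (U : Set M), 0 < C ∧ IsOpen U ∧ c ∈ U ∧
    U ⊆ (chartAt (EuclideanSpace ℝ (Fin n)) c).source ∧
    ∀ x ∈ U, ∀ w : TangentSpace (𝓡 n) x,
      ‖(show EuclideanSpace ℝ (Fin n) from
        mfderiv (𝓡 n) (𝓡 n) (chartAt (EuclideanSpace ℝ (Fin n)) c) x w)‖ ≤ C * ‖w‖ := by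
  have := isContinuousRiemannianBundle_tangent n M
  obtain ⟨C, hC, hev⟩ := eventually_norm_trivializationAt_lt (EuclideanSpace ℝ (Fin n))
    (TangentSpace (𝓡 n) (M := M)) c
  obtain ⟨V, hV, hVo, hcV⟩ := eventually_nhds_iff.1 hev
  refine ⟨C, V ∩ (chartAt (EuclideanSpace ℝ (Fin n)) c).source, hC,
    hVo.inter (chartAt _ c).open_source, ⟨hcV, mem_chart_source _ c⟩, inter_subset_right,
    fun x hx w => ?_⟩
  have h1 := ContinuousLinearMap.le_of_opNorm_le _ (hV x hx.1).le w
  rw [TangentBundle.continuousLinearMapAt_trivializationAt hx.2] at h1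
  exact h1

variable [T2Space M]

theorem smoothlyApproximable_of_tsupport_subset {c : M} {C : ℝ} {U : Set M} (hC : 0 < C)
    (hU : IsOpen U) (hUs : U ⊆ (chartAt (EuclideanSpace ℝ (Fin n)) c).source)
    (hUC : ∀ x ∈ U, ∀ w : TangentSpace (𝓡 n) x,
      ‖(show EuclideanSpace ℝ (Fin n) from
        mfderiv (𝓡 n) (𝓡 n) (chartAt (EuclideanSpace ℝ (Fin n)) c) x w)‖ ≤ C * ‖w‖)
    {T : M → ℝ} (hT : ContMDiff (𝓡 n) 𝓘(ℝ, ℝ) 1 T) (hTc : HasCompactSupport T)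
    (hT0 : ∀ x, 0 ≤ T x) (hTU : tsupport T ⊆ U) : SmoothlyApproximable n T := by
  set φ := chartAt (EuclideanSpace ℝ (Fin n)) c with hφ
  set K := tsupport T with hK
  have hKs : K ⊆ φ.source := hTU.trans hUs
  set g : EuclideanSpace ℝ (Fin n) → ℝ := φ.target.indicator (T ∘ φ.symm) with hg
  have hgK : tsupport g ⊆ φ '' K := tsupport_indicator_comp_symm_subset φ hTc hKs le_rfl
  have hφK : IsCompact (φ '' K) := IsCompact.image_of_continuousOn hTc (φ.continuousOn.mono hKs)
  have hφKt : φ '' K ⊆ φ.target := by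
    rintro _ ⟨x, hx, rfl⟩
    exact φ.map_source (hKs hx)
  have hφU : IsOpen (φ '' U) := φ.isOpen_image_of_subset_source hU hUs
  have hφUt : φ '' U ⊆ φ.target := by
    rintro _ ⟨x, hx, rfl⟩
    exact φ.map_source (hUs hx)
  have hg1 : ContDiff ℝ 1 g := by
    rw [← contMDiff_iff_contDiff]
    refine contMDiff_of_tsupport fun y hy => ?_
    have hyt : y ∈ φ.target := hφKt (hgK hy)
    have h1 : ContMDiffAt (𝓡 n) 𝓘(ℝ, ℝ) 1 (T ∘ φ.symm) y :=
      hT.contMDiffAt.comp y ((contMDiffOn_chart_symm (n := 1)).contMDiffAt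
        (φ.open_target.mem_nhds hyt))
    refine h1.congr_of_eventuallyEq ?_
    filter_upwards [φ.open_target.mem_nhds hyt] with z hz
    exact indicator_of_mem hz _
  have hg0 : ∀ y, 0 ≤ g y := fun y => indicator_nonneg (fun _ _ => hT0 _) y
  obtain ⟨K', hK', hK'U, hKK', hmol⟩ := exists_mollify hg1 hφK hgK hg0 hφU (image_mono hTU)
  have hK't : K' ⊆ φ.target := hK'U.trans hφUt
  have hsymK' : φ.symm '' K' ⊆ U := by
    rintro _ ⟨y, hy, rfl⟩
    obtain ⟨x, hx, rfl⟩ := hK'U hy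
    rwa [φ.left_inv (hUs hx)]
  have hKsym : K ⊆ φ.symm '' K' := fun x hx =>
    ⟨φ x, hKK' (mem_image_of_mem _ hx), φ.left_inv (hKs hx)⟩
  refine ⟨φ.symm '' K', hK'.image_of_continuousOn (φ.continuousOn_symm.mono hK't), hKsym,
    fun ε hε => ?_⟩
  obtain ⟨q, hq1, hq2, hq3, hq4, hq5⟩ := hmol (min ε (ε / C)) (by positivity)
  have hTg : ∀ x ∈ φ.source, T x = g (φ x) := fun x hx => by
    rw [hg, indicator_of_mem (φ.map_source hx), Function.comp_apply, φ.left_inv hx]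
  set ψ : M → ℝ := φ.source.indicator (q ∘ φ) with hψ
  have hψK : tsupport ψ ⊆ φ.symm '' K' :=
    tsupport_indicator_comp_symm_subset φ.symm hK' hK't hq2
  have hψs : ∀ x ∈ φ.source, ψ x = q (φ x) := fun x hx => indicator_of_mem hx _
  have hψ1 : ContMDiff (𝓡 n) 𝓘(ℝ, ℝ) ∞ ψ := by
    refine contMDiff_of_tsupport fun x hx => ?_
    have hxs : x ∈ φ.source := hUs (hsymK' (hψK hx))
    have h1 : ContMDiffAt (𝓡 n) 𝓘(ℝ, ℝ) ∞ (q ∘ φ) x :=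
      hq1.contMDiff.contMDiffAt.comp x ((contMDiffOn_chart (n := ∞)).contMDiffAt
        (φ.open_source.mem_nhds hxs))
    refine h1.congr_of_eventuallyEq ?_
    filter_upwards [φ.open_source.mem_nhds hxs] with z hz
    exact hψs z hz
  refine ⟨ψ, hψ1, hψK, fun x => indicator_nonneg (fun _ _ => hq3 _) x, fun x => ?_, fun x => ?_⟩
  · by_cases hx : x ∈ φ.source
    · rw [hψs x hx, hTg x hx]
      exact (hq4 _).trans (min_le_left _ _)
    · rw [hψ, indicator_of_notMem hx, image_eq_zero_of_notMem_tsupport fun h => hx (hKs h)]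
      simpa using hε.le
  · by_cases hx : x ∈ U
    · have hxs := hUs hx
      set w := grad (n := n) ψ x - grad (n := n) T x with hw
      have hd : HasMFDerivAt (𝓡 n) 𝓘(ℝ, ℝ) (fun z => q (φ z) - g (φ z)) x
          ((fderiv ℝ q (φ x) - fderiv ℝ g (φ x)).comp (mfderiv (𝓡 n) (𝓡 n) φ x)) := by
        have h1 : HasFDerivAt (fun y => q y - g y) (fderiv ℝ q (φ x) - fderiv ℝ g (φ x)) (φ x) :=
          ((hq1.differentiable (by simp)).differentiableAt.hasFDerivAt).sub
            ((hg1.differentiable (by simp)).differentiableAt.hasFDerivAt)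
        exact HasMFDerivAt.comp x h1.hasMFDerivAt
          ((mdifferentiable_chart (I := 𝓡 n) c).mdifferentiableAt hxs).hasMFDerivAt
      have hgr : HasGradAt (fun z => ψ z - T z) x w :=
        (hasGradAt_grad (hψ1.of_le (by simp)) x).sub (hasGradAt_grad hT x)
      have hev : (fun z => ψ z - T z) =ᶠ[𝓝 x] fun z => q (φ z) - g (φ z) := by
        filter_upwards [φ.open_source.mem_nhds hxs] with z hz
        rw [hψs z hz, hTg z hz]
      have hinner : inner ℝ w w = (fderiv ℝ q (φ x) - fderiv ℝ g (φ x))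
          (show EuclideanSpace ℝ (Fin n) from mfderiv (𝓡 n) (𝓡 n) φ x w) := by
        conv_lhs => rw [← hgr.2]
        rw [inner_grad, (hd.congr_of_eventuallyEq hev).mfderiv]
        rw [hgr.2]
        rfl
      have h2 : ‖w‖ * ‖w‖ ≤ ε * ‖w‖ := by
        rw [← real_inner_self_eq_norm_mul_norm, hinner]
        calc _ ≤ ‖(fderiv ℝ q (φ x) - fderiv ℝ g (φ x))
              (show EuclideanSpace ℝ (Fin n) from mfderiv (𝓡 n) (𝓡 n) φ x w)‖ := le_abs_self _
          _ ≤ (ε / C) * (C * ‖w‖) :=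
              (ContinuousLinearMap.le_opNorm _ _).trans
                (mul_le_mul ((hq5 _).trans (min_le_right _ _)) (hUC x hx w) (norm_nonneg _)
                  (by positivity))
          _ = ε * ‖w‖ := by field_simp
      rcases (norm_nonneg w).eq_or_lt with h0 | h0
      · rw [← h0]; exact hε.le
      · exact le_of_mul_le_mul_right h2 h0
    · rw [grad_eq_zero_of_notMem_tsupport fun h => hx (hsymK' (hψK h)),
        grad_eq_zero_of_notMem_tsupport fun h => hx (hTU h), sub_zero, norm_zero]
      exact hε.le

/-- Density of smooth test functions among `C¹` test functions. -/
theorem smoothlyApproximable_of_contMDiff [SigmaCompactSpace M] {T : M → ℝ}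
    (hT : ContMDiff (𝓡 n) 𝓘(ℝ, ℝ) 1 T) (hTc : HasCompactSupport T) (hT0 : ∀ x, 0 ≤ T x) :
    SmoothlyApproximable n T := by
  choose C U hC hU hcU hUs hUC using exists_norm_mfderiv_chart_le (n := n) (M := M)
  obtain ⟨η, hη⟩ := SmoothPartitionOfUnity.exists_isSubordinate (𝓡 n) (isClosed_univ (X := M)) U hU
    fun x _ => mem_iUnion.2 ⟨x, hcU x⟩
  have hfin : {c : M | (Function.support (η c) ∩ tsupport T).Nonempty}.Finite :=
    η.locallyFinite.finite_nonempty_inter_compact hTc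
  have hsum : T = fun x => ∑ c ∈ hfin.toFinset, η c x * T x := by
    funext x
    rw [← Finset.sum_mul]
    by_cases hx : x ∈ tsupport T
    · have h1 : ∑ᶠ c, η c x = ∑ c ∈ hfin.toFinset, η c x :=
        finsum_eq_sum_of_support_subset _ fun c hc => by
          rw [hfin.coe_toFinset]
          exact ⟨x, hc, hx⟩
      rw [← h1, η.sum_eq_one (mem_univ x), one_mul]
    · rw [image_eq_zero_of_notMem_tsupport hx, mul_zero]
  have hη1 : ∀ c, ContMDiff (𝓡 n) 𝓘(ℝ, ℝ) 1 (fun x => η c x * T x) := fun c =>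
    ((η c).contMDiff.of_le (by simp)).mul hT
  have hpiece : ∀ c, SmoothlyApproximable n (fun x => η c x * T x) := fun c =>
    smoothlyApproximable_of_tsupport_subset (hC c) (hU c) (hUs c) (hUC c) (hη1 c)
      hTc.mul_left (fun x => mul_nonneg (η.nonneg c x) (hT0 x))
      ((tsupport_mul_subset_left (f := fun x => η c x)).trans (hη c))
  have key : ∀ s : Finset M, ContMDiff (𝓡 n) 𝓘(ℝ, ℝ) 1 (fun x => ∑ c ∈ s, η c x * T x) ∧
      SmoothlyApproximable n (fun x => ∑ c ∈ s, η c x * T x) := by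
    classical
    intro s
    induction s using Finset.induction_on with
    | empty => simpa using ⟨contMDiff_const, smoothlyApproximable_zero⟩
    | insert c s hc ih =>
      simp only [Finset.sum_insert hc]
      exact ⟨(hη1 c).add ih.1, (hpiece c).add ih.2 (hη1 c) ih.1⟩
  rw [hsum]
  exact (key _).2

end ChartApprox

/-! ### Functions with vanishing gradient -/

section LocallyConstant

variable {n : ℕ} {M : Type*} [TopologicalSpace M]
  [ChartedSpace (EuclideanSpace ℝ (Fin n)) M] [IsManifold (𝓡 n) ∞ M]
  [RiemannianBundle (fun x : M => TangentSpace (𝓡 n) x)]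

theorem eventually_eq_of_grad_eq_zero {r : M → ℝ} {x : M}
    (hr : ContMDiff (𝓡 n) 𝓘(ℝ, ℝ) 1 r) (h : ∀ᶠ y in 𝓝 x, grad (n := n) r y = 0) :
    ∀ᶠ y in 𝓝 x, r y = r x := by
  set φ := chartAt (EuclideanSpace ℝ (Fin n)) x with hφ
  obtain ⟨O, hO, hOo, hxO⟩ := eventually_nhds_iff.1 h
  have hWo : IsOpen (φ.target ∩ φ.symm ⁻¹' O) := φ.symm.isOpen_inter_preimage hOo
  have hxs : x ∈ φ.source := mem_chart_source _ x
  have hxW : φ x ∈ φ.target ∩ φ.symm ⁻¹' O :=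
    ⟨φ.map_source hxs, by rwa [mem_preimage, φ.left_inv hxs]⟩
  obtain ⟨δ, hδ, hball⟩ := Metric.isOpen_iff.1 hWo _ hxW
  have hd : ∀ y ∈ Metric.ball (φ x) δ, HasFDerivAt (r ∘ φ.symm)
      (0 : EuclideanSpace ℝ (Fin n) →L[ℝ] ℝ) y := by
    intro y hy
    have h0 : mfderiv (𝓡 n) 𝓘(ℝ, ℝ) r (φ.symm y) = 0 := by
      ext w
      rw [← inner_grad, hO _ (hball hy).2, inner_zero_left]
      rfl
    have h1 : HasMFDerivAt (𝓡 n) 𝓘(ℝ, ℝ) r (φ.symm y) 0 :=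
      h0 ▸ (hr.mdifferentiableAt one_ne_zero).hasMFDerivAt
    have h2 := HasMFDerivAt.comp y h1
      ((mdifferentiable_chart (I := 𝓡 n) x).mdifferentiableAt_symm (hball hy).1).hasMFDerivAt
    rw [ContinuousLinearMap.zero_comp] at h2
    exact h2.hasFDerivAt
  have hconst : ∀ y ∈ Metric.ball (φ x) δ, r (φ.symm y) = r x := by
    intro y hy
    have := (convex_ball (φ x) δ).norm_image_sub_le_of_norm_hasFDerivWithin_le (𝕜 := ℝ)
      (f := r ∘ φ.symm) (f' := fun _ => 0) (C := 0)
      (fun z hz => (hd z hz).hasFDerivWithinAt) (fun z _ => by simp)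
      (Metric.mem_ball_self hδ) hy
    rw [zero_mul, norm_le_zero_iff, sub_eq_zero, Function.comp_apply, Function.comp_apply,
      φ.left_inv hxs] at this
    exact this
  filter_upwards [φ.open_source.mem_nhds hxs,
    (φ.continuousAt hxs).preimage_mem_nhds (Metric.ball_mem_nhds _ hδ)] with y hys hyb
  rw [← hconst _ hyb, φ.left_inv hys]

end LocallyConstant

/-! ### The weak inequalities tested with C¹ functions -/

section Testing

variable {n : ℕ} {M : Type*} [TopologicalSpace M]
  [ChartedSpace (EuclideanSpace ℝ (Fin n)) M] [IsManifold (𝓡 n) ∞ M]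
  [RiemannianBundle (fun x : M => TangentSpace (𝓡 n) x)]
  [IsContMDiffRiemannianBundle (𝓡 n) ∞ (EuclideanSpace ℝ (Fin n))
      (fun x : M => TangentSpace (𝓡 n) x)]
  [T2Space M] [SigmaCompactSpace M] [MeasurableSpace M] [BorelSpace M]

theorem pLaplacePairing_eq (p : ℝ) (u φ : M → ℝ) : pLaplacePairing (n := n) p u φ =
    ∫ x, inner ℝ (pFlux p (grad (n := n) u x)) (grad (n := n) φ x) ∂(riemVol n M) := by
  simp only [pLaplacePairing, pFlux, real_inner_smul_left]

theorem integrable_inner_pFlux_grad {p : ℝ} (hp : 1 < p) {u T : M → ℝ}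
    (hu : ContMDiff (𝓡 n) 𝓘(ℝ, ℝ) 1 u) (hT : ContMDiff (𝓡 n) 𝓘(ℝ, ℝ) 1 T)
    (hTc : HasCompactSupport T) :
    Integrable (fun x => inner ℝ (pFlux p (grad (n := n) u x)) (grad (n := n) T x))
      (riemVol n M) := by
  have := isFiniteMeasureOnCompacts_riemVol (n := n) (M := M)
  refine (continuous_inner_pFlux_grad hp hu (continuous_grad hT)).integrable_of_hasCompactSupport
    (HasCompactSupport.intro hTc fun x hx => ?_)
  rw [grad_eq_zero_of_notMem_tsupport hx, inner_zero_right]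

theorem integrable_mul_of_locallyIntegrable {F T : M → ℝ}
    (hF : LocallyIntegrable F (riemVol n M)) (hT : Continuous T) (hTc : HasCompactSupport T) :
    Integrable (fun x => F x * T x) (riemVol n M) := by
  simpa only [smul_eq_mul, mul_comm] using
    hF.integrable_smul_left_of_hasCompactSupport hT hTc

theorem exists_approx_pairing {p : ℝ} (hp : 1 < p) {u F T : M → ℝ}
    (hu : ContMDiff (𝓡 n) 𝓘(ℝ, ℝ) 1 u) (hF : LocallyIntegrable F (riemVol n M))
    (hT : ContMDiff (𝓡 n) 𝓘(ℝ, ℝ) 1 T) (hTc : HasCompactSupport T) (hT0 : ∀ x, 0 ≤ T x) :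
    ∀ ε : ℝ, 0 < ε → ∃ ψ : M → ℝ, ContMDiff (𝓡 n) 𝓘(ℝ, ℝ) ∞ ψ ∧
      HasCompactSupport ψ ∧ (∀ x, 0 ≤ ψ x) ∧
      |pLaplacePairing (n := n) p u ψ - pLaplacePairing (n := n) p u T| ≤ ε ∧
      |∫ x, F x * ψ x ∂(riemVol n M) - ∫ x, F x * T x ∂(riemVol n M)| ≤ ε := by
  have := isFiniteMeasureOnCompacts_riemVol (n := n) (M := M)
  obtain ⟨K, hK, hTK, h⟩ := smoothlyApproximable_of_contMDiff hT hTc hT0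
  set A := ∫ x in K, ‖grad (n := n) u x‖ ^ (p - 1) ∂(riemVol n M) with hA
  set B := ∫ x in K, |F x| ∂(riemVol n M) with hB
  have hA0 : 0 ≤ A := integral_nonneg fun x => by positivity
  have hB0 : 0 ≤ B := integral_nonneg fun x => abs_nonneg _
  intro ε hε
  set δ := ε / (A + B + 1) with hδ
  have hδ0 : 0 < δ := by positivity
  obtain ⟨ψ, h1, h2, h3, h4, h5⟩ := h δ hδ0
  have hψc : HasCompactSupport ψ := hK.of_isClosed_subset (isClosed_tsupport ψ) h2
  have hψ1 : ContMDiff (𝓡 n) 𝓘(ℝ, ℝ) 1 ψ := h1.of_le (by simp)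
  have hδA : δ * A ≤ ε := by
    rw [hδ, div_mul_eq_mul_div, div_le_iff₀ (by positivity)]
    nlinarith
  have hδB : δ * B ≤ ε := by
    rw [hδ, div_mul_eq_mul_div, div_le_iff₀ (by positivity)]
    nlinarith
  refine ⟨ψ, h1, hψc, h3, ?_, ?_⟩
  · have hgi : IntegrableOn (fun x => δ * ‖grad (n := n) u x‖ ^ (p - 1)) K (riemVol n M) :=
      ((continuous_const.mul ((continuous_norm_grad hu).rpow_const
        fun x => Or.inr (by linarith))).continuousOn).integrableOn_compact hK
    rw [pLaplacePairing_eq, pLaplacePairing_eq,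
      ← integral_sub (integrable_inner_pFlux_grad hp hu hψ1 hψc)
        (integrable_inner_pFlux_grad hp hu hT hTc)]
    rw [← Real.norm_eq_abs]
    refine (norm_integral_le_of_norm_le (hgi.integrable_indicator hK.measurableSet)
      (.of_forall fun x => ?_)).trans (le_of_eq_of_le ?_ hδA)
    · by_cases hx : x ∈ K
      · rw [indicator_of_mem hx, ← inner_sub_right]
        refine (norm_inner_le_norm _ _).trans ?_
        rw [norm_pFlux hp, mul_comm]
        gcongr
        exact h5 x
      · rw [indicator_of_notMem hx, grad_eq_zero_of_notMem_tsupport fun h => hx (h2 h),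
          grad_eq_zero_of_notMem_tsupport fun h => hx (hTK h)]
        simp
    · rw [integral_indicator hK.measurableSet, integral_const_mul]
  · have hgi : IntegrableOn (fun x => δ * |F x|) K (riemVol n M) :=
      (hF.integrableOn_isCompact hK).abs.const_mul δ
    rw [← integral_sub (integrable_mul_of_locallyIntegrable hF hψ1.continuous hψc)
        (integrable_mul_of_locallyIntegrable hF hT.continuous hTc)]
    rw [← Real.norm_eq_abs]
    refine (norm_integral_le_of_norm_le (hgi.integrable_indicator hK.measurableSet)
      (.of_forall fun x => ?_)).trans (le_of_eq_of_le ?_ hδB)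
    · by_cases hx : x ∈ K
      · rw [indicator_of_mem hx, ← mul_sub, norm_mul, mul_comm]
        exact mul_le_mul_of_nonneg_right (h4 x) (abs_nonneg _)
      · rw [indicator_of_notMem hx, image_eq_zero_of_notMem_tsupport fun h => hx (h2 h),
          image_eq_zero_of_notMem_tsupport fun h => hx (hTK h)]
        simp
    · rw [integral_indicator hK.measurableSet, integral_const_mul]

theorem WeakSupersolution.le_pLaplacePairing {p : ℝ} (hp : 1 < p) {u F T : M → ℝ}
    (h : WeakSupersolution (n := n) p u F) (hu : ContMDiff (𝓡 n) 𝓘(ℝ, ℝ) 1 u)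
    (hT : ContMDiff (𝓡 n) 𝓘(ℝ, ℝ) 1 T) (hTc : HasCompactSupport T) (hT0 : ∀ x, 0 ≤ T x) :
    ∫ x, F x * T x ∂(riemVol n M) ≤ pLaplacePairing (n := n) p u T := by
  refine le_of_forall_pos_le_add fun ε hε => ?_
  obtain ⟨ψ, h1, h2, h3, h4, h5⟩ := exists_approx_pairing hp hu h.1 hT hTc hT0 (ε / 2)
    (by positivity)
  have := h.2 ψ h1 h2 h3
  have h6 := (abs_le.1 h4).2
  have h7 := (abs_le.1 h5).1
  linarith

theorem WeakSubsolution.pLaplacePairing_le {p : ℝ} (hp : 1 < p) {u F T : M → ℝ}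
    (h : WeakSubsolution (n := n) p u F) (hu : ContMDiff (𝓡 n) 𝓘(ℝ, ℝ) 1 u)
    (hT : ContMDiff (𝓡 n) 𝓘(ℝ, ℝ) 1 T) (hTc : HasCompactSupport T) (hT0 : ∀ x, 0 ≤ T x) :
    pLaplacePairing (n := n) p u T ≤ ∫ x, F x * T x ∂(riemVol n M) := by
  refine le_of_forall_pos_le_add fun ε hε => ?_
  obtain ⟨ψ, h1, h2, h3, h4, h5⟩ := exists_approx_pairing hp hu h.1 hT hTc hT0 (ε / 2)
    (by positivity)
  have := h.2 ψ h1 h2 h3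
  have h6 := (abs_le.1 h4).1
  have h7 := (abs_le.1 h5).2
  linarith

end Testing

/-! ### Approximation in the Sobolev norm -/

section Sobolev

variable {n : ℕ} {M : Type*} [TopologicalSpace M]
  [ChartedSpace (EuclideanSpace ℝ (Fin n)) M] [IsManifold (𝓡 n) ∞ M]
  [RiemannianBundle (fun x : M => TangentSpace (𝓡 n) x)]
  [IsContMDiffRiemannianBundle (𝓡 n) ∞ (EuclideanSpace ℝ (Fin n))
      (fun x : M => TangentSpace (𝓡 n) x)]
  [T2Space M] [SigmaCompactSpace M] [MeasurableSpace M] [BorelSpace M]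

theorem integrable_norm_grad_rpow {p : ℝ} (hp : 1 < p) {w : M → ℝ}
    (hw : ContMDiff (𝓡 n) 𝓘(ℝ, ℝ) 1 w)
    (h : eLpNorm (fun x => ‖grad (n := n) w x‖) (ENNReal.ofReal p) (riemVol n M) < ⊤) :
    Integrable (fun x => ‖grad (n := n) w x‖ ^ p) (riemVol n M) := by
  have hm : MemLp (fun x => ‖grad (n := n) w x‖) (ENNReal.ofReal p) (riemVol n M) :=
    ⟨(continuous_norm_grad hw).aestronglyMeasurable, h⟩
  have := hm.integrable_norm_rpow (by simpa using by linarith) ENNReal.ofReal_ne_top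
  simpa only [norm_norm, ENNReal.toReal_ofReal (by linarith : 0 ≤ p)] using this

theorem integral_norm_grad_rpow_eq {p : ℝ} (hp : 1 < p) {w : M → ℝ}
    (hw : ContMDiff (𝓡 n) 𝓘(ℝ, ℝ) 1 w)
    (h : eLpNorm (fun x => ‖grad (n := n) w x‖) (ENNReal.ofReal p) (riemVol n M) < ⊤) :
    ∫ x, ‖grad (n := n) w x‖ ^ p ∂(riemVol n M) =
      (eLpNorm (fun x => ‖grad (n := n) w x‖) (ENNReal.ofReal p) (riemVol n M)).toReal ^ p := by
  have hm : MemLp (fun x => ‖grad (n := n) w x‖) (ENNReal.ofReal p) (riemVol n M) :=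
    ⟨(continuous_norm_grad hw).aestronglyMeasurable, h⟩
  have hp0 : 0 < p := by linarith
  have h0 : 0 ≤ ∫ x, ‖grad (n := n) w x‖ ^ p ∂(riemVol n M) :=
    integral_nonneg fun x => by positivity
  rw [hm.eLpNorm_eq_integral_rpow_norm (by simpa using by linarith) ENNReal.ofReal_ne_top]
  simp only [norm_norm, ENNReal.toReal_ofReal hp0.le]
  rw [ENNReal.toReal_ofReal (by positivity), Real.rpow_inv_rpow h0 hp0.ne']

theorem MemW0C1.integrable_norm_grad_rpow {p : ℝ} (hp : 1 < p) {u : M → ℝ}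
    (hu : MemW0C1 (n := n) p u) :
    Integrable (fun x => ‖grad (n := n) u x‖ ^ p) (riemVol n M) := by
  have := isFiniteMeasureOnCompacts_riemVol (n := n) (M := M)
  obtain ⟨φ, h1, h2, h3⟩ := hu.2 1 one_pos
  have hφ1 : ContMDiff (𝓡 n) 𝓘(ℝ, ℝ) 1 φ := h1.of_le (by simp)
  have hw : ContMDiff (𝓡 n) 𝓘(ℝ, ℝ) 1 (fun x => u x - φ x) := hu.1.sub hφ1
  refine RiemPLaplace.integrable_norm_grad_rpow hp hu.1 ?_
  have m1 : MemLp (fun x => ‖grad (n := n) (fun x => u x - φ x) x‖) (ENNReal.ofReal p)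
      (riemVol n M) :=
    ⟨(continuous_norm_grad hw).aestronglyMeasurable,
      (le_self_add.trans_lt h3).trans ENNReal.one_lt_top⟩
  have m2 : MemLp (fun x => ‖grad (n := n) φ x‖) (ENNReal.ofReal p) (riemVol n M) :=
    (continuous_norm_grad hφ1).memLp_of_hasCompactSupport
      (HasCompactSupport.intro h2 fun x hx => by
        rw [grad_eq_zero_of_notMem_tsupport hx, norm_zero])
  refine ((m1.add m2).mono (continuous_norm_grad hu.1).aestronglyMeasurable
    (.of_forall fun x => ?_)).2
  rw [norm_norm, Pi.add_apply, Real.norm_of_nonneg (by positivity),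
    ((hasGradAt_grad hu.1 x).sub (hasGradAt_grad hφ1 x)).2]
  calc ‖grad (n := n) u x‖ = ‖(grad (n := n) u x - grad (n := n) φ x) + grad (n := n) φ x‖ := by
        rw [sub_add_cancel]
    _ ≤ _ := norm_add_le _ _

/-- The approximating sequence can be chosen to converge almost everywhere: convergence in `L^p` gives
convergence in measure, hence almost everywhere along a subsequence. -/
theorem MemW0C1.exists_seq {p : ℝ} (hp : 1 < p) {v : M → ℝ} (hv : MemW0C1 (n := n) p v) :
    ∃ φ : ℕ → M → ℝ, (∀ k, ContMDiff (𝓡 n) 𝓘(ℝ, ℝ) ∞ (φ k)) ∧ (∀ k, HasCompactSupport (φ k)) ∧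
      (∀ k, Integrable (fun x => ‖grad (n := n) v x - grad (n := n) (φ k) x‖ ^ p)
        (riemVol n M)) ∧
      Tendsto (fun k => ∫ x, ‖grad (n := n) v x - grad (n := n) (φ k) x‖ ^ p ∂(riemVol n M))
        atTop (𝓝 0) ∧
      ∀ᵐ x ∂(riemVol n M), Tendsto (fun k => φ k x) atTop (𝓝 (v x)) := by
  have hp0 : 0 < p := by linarith
  have hpos : ∀ k : ℕ, (0 : ℝ≥0∞) < ((k : ℝ≥0∞) + 1)⁻¹ := fun k => by simp
  have hlim : Tendsto (fun k : ℕ => ((k : ℝ≥0∞) + 1)⁻¹) atTop (𝓝 0) := by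
    have := (tendsto_add_atTop_iff_nat 1).2 ENNReal.tendsto_inv_nat_nhds_zero
    simpa using this
  choose φ h1 h2 h3 using fun k : ℕ => hv.2 _ (hpos k)
  have hφ1 : ∀ k, ContMDiff (𝓡 n) 𝓘(ℝ, ℝ) 1 (φ k) := fun k => (h1 k).of_le (by simp)
  have hw : ∀ k, ContMDiff (𝓡 n) 𝓘(ℝ, ℝ) 1 (fun x => v x - φ k x) := fun k => hv.1.sub (hφ1 k)
  have hgr : ∀ k x, grad (n := n) (fun x => v x - φ k x) x =
      grad (n := n) v x - grad (n := n) (φ k) x := fun k x =>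
    ((hasGradAt_grad hv.1 x).sub (hasGradAt_grad (hφ1 k) x)).2
  have hg1 : ∀ k, eLpNorm (fun x => ‖grad (n := n) (fun x => v x - φ k x) x‖) (ENNReal.ofReal p)
      (riemVol n M) ≤ ((k : ℝ≥0∞) + 1)⁻¹ := fun k => le_self_add.trans (h3 k).le
  have hg2 : ∀ k, eLpNorm (fun x => v x - φ k x) (ENNReal.ofReal p)
      (riemVol n M) ≤ ((k : ℝ≥0∞) + 1)⁻¹ := fun k => le_add_self.trans (h3 k).le
  have hfin : ∀ k, eLpNorm (fun x => ‖grad (n := n) (fun x => v x - φ k x) x‖) (ENNReal.ofReal p)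
      (riemVol n M) < ⊤ := fun k => (hg1 k).trans_lt (by simp)
  have ht1 : Tendsto (fun k => ∫ x, ‖grad (n := n) v x - grad (n := n) (φ k) x‖ ^ p
      ∂(riemVol n M)) atTop (𝓝 0) := by
    have e : ∀ k, ∫ x, ‖grad (n := n) v x - grad (n := n) (φ k) x‖ ^ p ∂(riemVol n M) =
        (eLpNorm (fun x => ‖grad (n := n) (fun x => v x - φ k x) x‖) (ENNReal.ofReal p)
          (riemVol n M)).toReal ^ p := fun k => by
      rw [← integral_norm_grad_rpow_eq hp (hw k) (hfin k)]
      simp only [hgr]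
    simp only [e]
    have h4 := tendsto_of_tendsto_of_tendsto_of_le_of_le tendsto_const_nhds hlim
      (fun k => zero_le) hg1
    have h5 := ((ENNReal.tendsto_toReal ENNReal.zero_ne_top).comp h4).rpow_const
      (p := p) (Or.inr hp0.le)
    simpa [Real.zero_rpow hp0.ne'] using h5
  have ht2 : Tendsto (fun k => eLpNorm (φ k - v) (ENNReal.ofReal p) (riemVol n M)) atTop (𝓝 0) := by
    refine tendsto_of_tendsto_of_tendsto_of_le_of_le tendsto_const_nhds hlim
      (fun k => zero_le) fun k => ?_
    rw [eLpNorm_sub_comm]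
    exact hg2 k
  have hmeas := tendstoInMeasure_of_tendsto_eLpNorm (by simpa using hp0)
    (fun k => (hφ1 k).continuous.aestronglyMeasurable) hv.1.continuous.aestronglyMeasurable ht2
  obtain ⟨ns, hns, hae⟩ := hmeas.exists_seq_tendsto_ae
  refine ⟨fun k => φ (ns k), fun k => h1 _, fun k => h2 _, fun k => ?_,
    ht1.comp hns.tendsto_atTop, hae⟩
  simpa only [hgr] using RiemPLaplace.integrable_norm_grad_rpow hp (hw (ns k)) (hfin (ns k))

end Sobolev

/-! ### The transition function -/

section Transition

theorem hasDerivAt_smoothTransition (s : ℝ) :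
    HasDerivAt Real.smoothTransition (deriv Real.smoothTransition s) s :=
  ((Real.smoothTransition.contDiff (n := 1)).differentiable (by simp)).differentiableAt.hasDerivAt

theorem continuous_deriv_smoothTransition : Continuous (deriv Real.smoothTransition) :=
  (Real.smoothTransition.contDiff (n := 1)).continuous_deriv (by simp)

theorem deriv_smoothTransition_nonneg (s : ℝ) : 0 ≤ deriv Real.smoothTransition s :=
  Real.smoothTransition.monotone.deriv_nonneg

theorem mem_Icc_of_deriv_smoothTransition_ne_zero {s : ℝ}
    (h : deriv Real.smoothTransition s ≠ 0) : s ∈ Icc (0 : ℝ) 1 := by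
  by_contra hs
  rw [mem_Icc, not_and_or, not_le, not_le] at hs
  refine h ?_
  rcases hs with hs | hs
  · have : Real.smoothTransition =ᶠ[𝓝 s] fun _ => 0 := by
      filter_upwards [Iio_mem_nhds hs] with y hy
      exact Real.smoothTransition.zero_of_nonpos (le_of_lt hy)
    rw [this.deriv_eq, deriv_const]
  · have : Real.smoothTransition =ᶠ[𝓝 s] fun _ => 1 := by
      filter_upwards [Ioi_mem_nhds hs] with y hy
      exact Real.smoothTransition.one_of_one_le (le_of_lt hy)
    rw [this.deriv_eq, deriv_const]

theorem exists_deriv_smoothTransition_le :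
    ∃ C : ℝ, 0 ≤ C ∧ ∀ s, deriv Real.smoothTransition s ≤ C := by
  obtain ⟨C, hC⟩ := (isCompact_Icc (a := (0 : ℝ)) (b := 1)).exists_bound_of_continuousOn
    continuous_deriv_smoothTransition.continuousOn
  refine ⟨max C 0, le_max_right _ _, fun s => ?_⟩
  by_cases h : deriv Real.smoothTransition s = 0
  · rw [h]; exact le_max_right _ _
  · exact (le_abs_self _).trans
      ((hC s (mem_Icc_of_deriv_smoothTransition_ne_zero h)).trans (le_max_left _ _))

/-- The profile `s ↦ s^p β(s)` with `β(s) = smoothTransition (s - 1)`. -/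
def profile (p s : ℝ) : ℝ := s ^ p * Real.smoothTransition (s - 1)

theorem hasDerivAt_transition_sub_one (s : ℝ) :
    HasDerivAt (fun s => Real.smoothTransition (s - 1)) (deriv Real.smoothTransition (s - 1)) s := by
  simpa using (hasDerivAt_smoothTransition (s - 1)).comp_sub_const s 1

theorem hasDerivAt_profile {p : ℝ} (hp : 1 < p) (s : ℝ) :
    HasDerivAt (profile p) (p * s ^ (p - 1) * Real.smoothTransition (s - 1) +
      s ^ p * deriv Real.smoothTransition (s - 1)) s :=
  (Real.hasDerivAt_rpow_const (Or.inr hp.le)).mul (hasDerivAt_transition_sub_one s)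

theorem contDiff_rpow_of_one_lt {p : ℝ} (hp : 1 < p) : ContDiff ℝ 1 (fun s : ℝ => s ^ p) :=
  Real.contDiff_rpow_const_of_le (n := 1) (by exact_mod_cast hp.le)

theorem contDiff_transition_sub_one :
    ContDiff ℝ 1 (fun s : ℝ => Real.smoothTransition (s - 1)) :=
  (Real.smoothTransition.contDiff (n := 1)).comp (contDiff_id.sub contDiff_const)

theorem contDiff_profile {p : ℝ} (hp : 1 < p) : ContDiff ℝ 1 (profile p) :=
  (contDiff_rpow_of_one_lt hp).mul contDiff_transition_sub_one

end Transition

/-! ### The test functions -/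

section TestFunctions

variable {n : ℕ} {M : Type*} [TopologicalSpace M]
  [ChartedSpace (EuclideanSpace ℝ (Fin n)) M] [IsManifold (𝓡 n) ∞ M]
  [RiemannianBundle (fun x : M => TangentSpace (𝓡 n) x)]

/-- The test function `u r^p β(r)`, `r = v ζ / u`, for the supersolution `u`; the cut-off `ζ` makes
it compactly supported. -/
def superTest (p : ℝ) (u v ζ : M → ℝ) (x : M) : ℝ := u x * profile p (v x * ζ x / u x)

/-- The test function `v ζ^p β(r)`, `r = v ζ / u`, for the subsolution `v`. -/
def subTest (p : ℝ) (u v ζ : M → ℝ) (x : M) : ℝ :=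
  v x * (ζ x ^ p * Real.smoothTransition (v x * ζ x / u x - 1))

theorem contMDiff_div {u w : M → ℝ} (hw : ContMDiff (𝓡 n) 𝓘(ℝ, ℝ) 1 w)
    (hu : ContMDiff (𝓡 n) 𝓘(ℝ, ℝ) 1 u) (hu0 : ∀ x, 0 < u x) :
    ContMDiff (𝓡 n) 𝓘(ℝ, ℝ) 1 (fun x => w x / u x) := by
  simp only [div_eq_mul_inv]
  exact hw.mul fun x => ((contDiffAt_inv ℝ (hu0 x).ne').contMDiffAt).comp x hu.contMDiffAt

variable {p : ℝ} {u v ζ : M → ℝ}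

theorem contMDiff_superTest (hp : 1 < p) (hu : ContMDiff (𝓡 n) 𝓘(ℝ, ℝ) 1 u)
    (hv : ContMDiff (𝓡 n) 𝓘(ℝ, ℝ) 1 v) (hζ : ContMDiff (𝓡 n) 𝓘(ℝ, ℝ) 1 ζ) (hu0 : ∀ x, 0 < u x) :
    ContMDiff (𝓡 n) 𝓘(ℝ, ℝ) 1 (superTest p u v ζ) :=
  hu.mul ((contDiff_profile hp).contMDiff.comp (contMDiff_div (hv.mul hζ) hu hu0))

theorem contMDiff_subTest (hp : 1 < p) (hu : ContMDiff (𝓡 n) 𝓘(ℝ, ℝ) 1 u)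
    (hv : ContMDiff (𝓡 n) 𝓘(ℝ, ℝ) 1 v) (hζ : ContMDiff (𝓡 n) 𝓘(ℝ, ℝ) 1 ζ) (hu0 : ∀ x, 0 < u x) :
    ContMDiff (𝓡 n) 𝓘(ℝ, ℝ) 1 (subTest p u v ζ) :=
  hv.mul (((contDiff_rpow_of_one_lt hp).contMDiff.comp hζ).mul
    (contDiff_transition_sub_one.contMDiff.comp (contMDiff_div (hv.mul hζ) hu hu0)))

theorem hasGradAt_ratio (hu : ContMDiff (𝓡 n) 𝓘(ℝ, ℝ) 1 u)
    (hv : ContMDiff (𝓡 n) 𝓘(ℝ, ℝ) 1 v) (hζ : ContMDiff (𝓡 n) 𝓘(ℝ, ℝ) 1 ζ) (hu0 : ∀ x, 0 < u x)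
    (x : M) : HasGradAt (fun y => v y * ζ y / u y) x
      ((u x)⁻¹ • (v x • grad (n := n) ζ x + ζ x • grad (n := n) v x
        - (v x * ζ x / u x) • grad (n := n) u x)) :=
  ((hasGradAt_grad hv x).mul (hasGradAt_grad hζ x)).div (hasGradAt_grad hu x) (hu0 x).ne'

theorem grad_superTest (hp : 1 < p) (hu : ContMDiff (𝓡 n) 𝓘(ℝ, ℝ) 1 u)
    (hv : ContMDiff (𝓡 n) 𝓘(ℝ, ℝ) 1 v) (hζ : ContMDiff (𝓡 n) 𝓘(ℝ, ℝ) 1 ζ) (hu0 : ∀ x, 0 < u x)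
    {x : M} {r b b' : ℝ} (hr : r = v x * ζ x / u x) (hb : b = Real.smoothTransition (r - 1))
    (hb' : b' = deriv Real.smoothTransition (r - 1)) :
    grad (n := n) (superTest p u v ζ) x = (r ^ p * b) • grad (n := n) u x +
      (p * r ^ (p - 1) * b + r ^ p * b') • (v x • grad (n := n) ζ x + ζ x • grad (n := n) v x
        - r • grad (n := n) u x) := by
  have h := (hasGradAt_grad hu x).mul
    ((hasGradAt_ratio hu hv hζ hu0 x).comp_real (hasDerivAt_profile hp _))
  refine h.2.trans ?_
  rw [← hr, ← hb, ← hb', profile, ← hb, smul_smul, smul_smul, add_comm]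
  congr 2
  have := (hu0 x).ne'
  field_simp

theorem grad_subTest (hp : 1 < p) (hu : ContMDiff (𝓡 n) 𝓘(ℝ, ℝ) 1 u)
    (hv : ContMDiff (𝓡 n) 𝓘(ℝ, ℝ) 1 v) (hζ : ContMDiff (𝓡 n) 𝓘(ℝ, ℝ) 1 ζ) (hu0 : ∀ x, 0 < u x)
    {x : M} {r b b' : ℝ} (hr : r = v x * ζ x / u x) (hb : b = Real.smoothTransition (r - 1))
    (hb' : b' = deriv Real.smoothTransition (r - 1)) :
    grad (n := n) (subTest p u v ζ) x = (ζ x ^ p * b) • grad (n := n) v x +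
      (p * ζ x ^ (p - 1) * b) • (v x • grad (n := n) ζ x) +
      (v x / u x * ζ x ^ p * b') • (v x • grad (n := n) ζ x + ζ x • grad (n := n) v x
        - r • grad (n := n) u x) := by
  have h := (hasGradAt_grad hv x).mul
    (((hasGradAt_grad hζ x).comp_real (Real.hasDerivAt_rpow_const (Or.inr hp.le))).mul
    ((hasGradAt_ratio hu hv hζ hu0 x).comp_real (hasDerivAt_transition_sub_one _)))
  refine h.2.trans ?_
  rw [← hr, ← hb, ← hb']
  have := (hu0 x).ne'
  module

theorem superTest_nonneg (hu0 : ∀ x, 0 < u x) (hv0 : ∀ x, 0 < v x) (hζ0 : ∀ x, 0 ≤ ζ x) (x : M) :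
    0 ≤ superTest p u v ζ x :=
  mul_nonneg (hu0 x).le (mul_nonneg (Real.rpow_nonneg
    (div_nonneg (mul_nonneg (hv0 x).le (hζ0 x)) (hu0 x).le) _) (Real.smoothTransition.nonneg _))

theorem subTest_nonneg (hv0 : ∀ x, 0 < v x) (hζ0 : ∀ x, 0 ≤ ζ x) (x : M) :
    0 ≤ subTest p u v ζ x :=
  mul_nonneg (hv0 x).le (mul_nonneg (Real.rpow_nonneg (hζ0 x) _) (Real.smoothTransition.nonneg _))

theorem hasCompactSupport_superTest (hp : 1 < p) (hζ : HasCompactSupport ζ) :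
    HasCompactSupport (superTest p u v ζ) :=
  hζ.mono fun x hx h0 => hx (by
    rw [superTest, profile, h0, mul_zero, zero_div, Real.zero_rpow (by linarith), zero_mul,
      mul_zero])

theorem hasCompactSupport_subTest (hp : 1 < p) (hζ : HasCompactSupport ζ) :
    HasCompactSupport (subTest p u v ζ) :=
  hζ.mono fun x hx h0 => hx (by
    rw [subTest, h0, Real.zero_rpow (by linarith), zero_mul, mul_zero])

end TestFunctions

/-! ### Sign of the source terms -/

section Gap

/-- Expansion of the monotonicity defect, which shows its continuity in the two scalars. -/
theorem pDefect_smul_smul {E : Type*} [NormedAddCommGroup E] [InnerProductSpace ℝ E] {p : ℝ}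
    (hp : 1 < p) {a b : ℝ} (ha : 0 ≤ a) (hb : 0 ≤ b) (X Y : E) :
    pDefect p (a • X) (b • Y) = a ^ (p - 1) * a * ‖X‖ ^ p - a ^ (p - 1) * b * inner ℝ (pFlux p X) Y
      - b ^ (p - 1) * a * inner ℝ (pFlux p Y) X + b ^ (p - 1) * b * ‖Y‖ ^ p := by
  rw [pDefect, pFlux_smul hp ha, pFlux_smul hp hb, ← inner_pFlux_self hp X,
    ← inner_pFlux_self hp Y]
  simp only [inner_sub_left, inner_sub_right, real_inner_smul_left, real_inner_smul_right]
  ring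

/-- Where the test functions are positive one has `v > u`, and there the difference of the two
right-hand sides is controlled by the monotonicity of `s ↦ f s / s ^ (p - 1)`. -/
theorem source_gap_eq {p : ℝ} {f : ℝ → ℝ} {a b s H : ℝ} (ha : 0 < a) (hb : 0 < b) (hs : 0 ≤ s) :
    H * f a * (a * profile p (b * s / a)) -
      H * f b * (b * (s ^ p * Real.smoothTransition (b * s / a - 1))) =
    H * ((b * s) ^ p * Real.smoothTransition (b * s / a - 1)) *
      (f a / a ^ (p - 1) - f b / b ^ (p - 1)) := by
  have h1 : a ^ p = a ^ (p - 1) * a := by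
    rw [← Real.rpow_add_one ha.ne']; congr 1; ring
  have h2 : b ^ p = b ^ (p - 1) * b := by
    rw [← Real.rpow_add_one hb.ne']; congr 1; ring
  have h3 : a ^ (p - 1) ≠ 0 := by positivity
  have h4 : b ^ (p - 1) ≠ 0 := by positivity
  rw [profile, Real.div_rpow (by positivity) ha.le, Real.mul_rpow hb.le hs, h1, h2]
  field_simp

theorem source_gap_nonneg {p : ℝ} {f : ℝ → ℝ}
    (hf : StrictAntiOn (fun s => f s / s ^ (p - 1)) (Ioi 0)) {a b s H : ℝ} (ha : 0 < a)
    (hb : 0 < b) (hs : 0 ≤ s) (hs1 : s ≤ 1) (hH : 0 ≤ H) :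
    0 ≤ H * f a * (a * profile p (b * s / a)) -
      H * f b * (b * (s ^ p * Real.smoothTransition (b * s / a - 1))) := by
  rw [source_gap_eq ha hb hs]
  rcases le_or_gt (b * s / a) 1 with h | h
  · rw [Real.smoothTransition.zero_of_nonpos (by linarith)]; simp
  · have hab : a < b := by
      rw [lt_div_iff₀ ha, one_mul] at h
      exact h.trans_le (mul_le_of_le_one_right hb.le hs1)
    have := hf ha hb hab
    simp only at this
    have h5 := Real.smoothTransition.nonneg (b * s / a - 1)
    have h6 : 0 ≤ (b * s) ^ p := by positivity
    exact mul_nonneg (mul_nonneg hH (mul_nonneg h6 h5)) (by linarith)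

end Gap

/-! ### The energy estimate -/

section Energy

variable {n : ℕ} {M : Type*} [TopologicalSpace M]
  [ChartedSpace (EuclideanSpace ℝ (Fin n)) M] [IsManifold (𝓡 n) ∞ M]
  [RiemannianBundle (fun x : M => TangentSpace (𝓡 n) x)]

/-- The nonnegative integrand controlled by the two tested inequalities, as a function of the value
`s ∈ [0, 1]` of the cut-off at `x`. -/
def gap (n : ℕ) {M : Type*} [TopologicalSpace M]
    [ChartedSpace (EuclideanSpace ℝ (Fin n)) M] [IsManifold (𝓡 n) ∞ M]
    [RiemannianBundle (fun x : M => TangentSpace (𝓡 n) x)]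
    (p : ℝ) (f : ℝ → ℝ) (h u v : M → ℝ) (s : ℝ) (x : M) : ℝ :=
  (h x * f (u x) * (u x * profile p (v x * s / u x)) -
    h x * f (v x) * (v x * (s ^ p * Real.smoothTransition (v x * s / u x - 1)))) +
  deriv Real.smoothTransition (v x * s / u x - 1) * (v x * s / u x) *
    pDefect p ((v x * s / u x) • grad (n := n) u x) (s • grad (n := n) v x)

variable {p : ℝ} {f : ℝ → ℝ} {h u v : M → ℝ}

theorem gap_nonneg (hp : 1 < p) (hf : StrictAntiOn (fun s => f s / s ^ (p - 1)) (Ioi 0)) {x : M}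
    (hu : 0 < u x) (hv : 0 < v x) (hh : 0 ≤ h x) {s : ℝ} (hs : 0 ≤ s) (hs1 : s ≤ 1) :
    0 ≤ gap n p f h u v s x :=
  add_nonneg (source_gap_nonneg hf hu hv hs hs1 hh)
    (mul_nonneg (mul_nonneg (deriv_smoothTransition_nonneg _) (by positivity))
      (pDefect_nonneg hp _ _))

theorem tendsto_gap (hp : 1 < p) {x : M} (hu : 0 < u x) (hv : 0 < v x) {s : ℕ → ℝ}
    (hs : ∀ k, 0 ≤ s k) (hlim : Tendsto s atTop (𝓝 1)) :
    Tendsto (fun k => gap n p f h u v (s k) x) atTop (𝓝 (gap n p f h u v 1 x)) := by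
  have hr : Tendsto (fun k => v x * s k / u x) atTop (𝓝 (v x * 1 / u x)) :=
    (hlim.const_mul _).div_const _
  have hp1 : 0 ≤ p - 1 := by linarith
  have hd : Tendsto (fun k => pDefect p ((v x * s k / u x) • grad (n := n) u x)
      (s k • grad (n := n) v x)) atTop
      (𝓝 (pDefect p ((v x * 1 / u x) • grad (n := n) u x) ((1 : ℝ) • grad (n := n) v x))) := by
    have e : ∀ k, pDefect p ((v x * s k / u x) • grad (n := n) u x) (s k • grad (n := n) v x) = _ :=
      fun k => pDefect_smul_smul hp
        (div_nonneg (mul_nonneg hv.le (hs k)) hu.le) (hs k) _ _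
    simp only [e]
    rw [pDefect_smul_smul hp (by positivity) zero_le_one]
    have hr' := hr.rpow_const (p := p - 1) (Or.inr hp1)
    have hs' := hlim.rpow_const (p := p - 1) (Or.inr hp1)
    exact ((((hr'.mul hr).mul_const _).sub ((hr'.mul hlim).mul_const _)).sub
      ((hs'.mul hr).mul_const _)).add ((hs'.mul hlim).mul_const _)
  have hS : Tendsto (fun k => Real.smoothTransition (v x * s k / u x - 1)) atTop
      (𝓝 (Real.smoothTransition (v x * 1 / u x - 1))) :=
    (Real.smoothTransition.continuous.tendsto _).comp (hr.sub_const 1)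
  have hS' : Tendsto (fun k => deriv Real.smoothTransition (v x * s k / u x - 1)) atTop
      (𝓝 (deriv Real.smoothTransition (v x * 1 / u x - 1))) :=
    (continuous_deriv_smoothTransition.tendsto _).comp (hr.sub_const 1)
  have hpr : Tendsto (fun k => profile p (v x * s k / u x)) atTop
      (𝓝 (profile p (v x * 1 / u x))) :=
    ((contDiff_profile hp).continuous.tendsto _).comp hr
  exact (((hpr.const_mul _).const_mul _).sub
    ((((hlim.rpow_const (Or.inr (by linarith))).mul hS).const_mul _).const_mul _)).add
    ((hS'.mul hr).mul hd)

variable [IsContMDiffRiemannianBundle (𝓡 n) ∞ (EuclideanSpace ℝ (Fin n))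
      (fun x : M => TangentSpace (𝓡 n) x)]

theorem continuous_defect (hp : 1 < p) {ζ : M → ℝ} (hu : ContMDiff (𝓡 n) 𝓘(ℝ, ℝ) 1 u)
    (hv : ContMDiff (𝓡 n) 𝓘(ℝ, ℝ) 1 v) (hu0 : ∀ x, 0 < u x) (hv0 : ∀ x, 0 < v x)
    (hζ : Continuous ζ) (hζ0 : ∀ x, 0 ≤ ζ x) :
    Continuous fun x => deriv Real.smoothTransition (v x * ζ x / u x - 1) * (v x * ζ x / u x) *
      pDefect p ((v x * ζ x / u x) • grad (n := n) u x) (ζ x • grad (n := n) v x) := by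
  have hr : Continuous fun x => v x * ζ x / u x :=
    (hv.continuous.mul hζ).div hu.continuous fun x => (hu0 x).ne'
  have hp1 : 0 ≤ p - 1 := by linarith
  have e : ∀ x, pDefect p ((v x * ζ x / u x) • grad (n := n) u x) (ζ x • grad (n := n) v x) = _ :=
    fun x => pDefect_smul_smul hp
      (div_nonneg (mul_nonneg (hv0 x).le (hζ0 x)) (hu0 x).le) (hζ0 x) _ _
  simp only [e]
  have hr' : Continuous fun x => (v x * ζ x / u x) ^ (p - 1) := hr.rpow_const fun _ => Or.inr hp1
  have hζ' : Continuous fun x => ζ x ^ (p - 1) := hζ.rpow_const fun _ => Or.inr hp1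
  have hX : Continuous fun x => ‖grad (n := n) u x‖ ^ p :=
    (continuous_norm_grad hu).rpow_const fun _ => Or.inr (by linarith)
  have hY : Continuous fun x => ‖grad (n := n) v x‖ ^ p :=
    (continuous_norm_grad hv).rpow_const fun _ => Or.inr (by linarith)
  have hXY := continuous_inner_pFlux_grad hp hu (continuous_grad hv)
  have hYX := continuous_inner_pFlux_grad hp hv (continuous_grad hu)
  exact ((continuous_deriv_smoothTransition.comp (hr.sub continuous_const)).mul hr).mul
    (((((hr'.mul hr).mul hX).sub ((hr'.mul hζ).mul hXY)).sub ((hζ'.mul hr).mul hYX)).add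
      ((hζ'.mul hζ).mul hY))

variable [T2Space M] [SigmaCompactSpace M] [MeasurableSpace M] [BorelSpace M]

theorem aemeasurable_gap (hp : 1 < p) {ζ : M → ℝ} (hu : ContMDiff (𝓡 n) 𝓘(ℝ, ℝ) 1 u)
    (hv : ContMDiff (𝓡 n) 𝓘(ℝ, ℝ) 1 v) (hu0 : ∀ x, 0 < u x) (hv0 : ∀ x, 0 < v x)
    (hFu : LocallyIntegrable (fun x => h x * f (u x)) (riemVol n M))
    (hFv : LocallyIntegrable (fun x => h x * f (v x)) (riemVol n M))
    (hζ : ContMDiff (𝓡 n) 𝓘(ℝ, ℝ) 1 ζ) (hζc : HasCompactSupport ζ) (hζ0 : ∀ x, 0 ≤ ζ x) :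
    AEMeasurable (fun x => gap n p f h u v (ζ x) x) (riemVol n M) :=
  ((integrable_mul_of_locallyIntegrable hFu (contMDiff_superTest hp hu hv hζ hu0).continuous
    (hasCompactSupport_superTest hp hζc)).aestronglyMeasurable.aemeasurable.sub
  (integrable_mul_of_locallyIntegrable hFv (contMDiff_subTest hp hu hv hζ hu0).continuous
    (hasCompactSupport_subTest hp hζc)).aestronglyMeasurable.aemeasurable).add
  (continuous_defect hp hu hv hu0 hv0 hζ.continuous hζ0).aemeasurable

theorem integrable_norm_smul_grad_rpow (hp : 1 < p) {ζ : M → ℝ}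
    (hv : ContMDiff (𝓡 n) 𝓘(ℝ, ℝ) 1 v) (hζ : ContMDiff (𝓡 n) 𝓘(ℝ, ℝ) 1 ζ)
    (hζc : HasCompactSupport ζ) :
    Integrable (fun x => ‖v x • grad (n := n) ζ x‖ ^ p) (riemVol n M) := by
  have := isFiniteMeasureOnCompacts_riemVol (n := n) (M := M)
  simp only [norm_smul]
  refine Continuous.integrable_of_hasCompactSupport
    ((hv.continuous.norm.mul (continuous_norm_grad hζ)).rpow_const fun _ => Or.inr (by linarith))
    (HasCompactSupport.intro hζc fun x hx => ?_)
  rw [grad_eq_zero_of_notMem_tsupport hx, norm_zero, mul_zero, Real.zero_rpow (by linarith)]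

/-- The energy estimate: subtracting the two tested inequalities bounds the integral of the gap by
the terms that contain the gradient of the cut-off `ζ`, up to a small multiple of the energies. -/
theorem exists_lintegral_gap_le (hp : 1 < p)
    (hf : StrictAntiOn (fun s => f s / s ^ (p - 1)) (Ioi 0))
    (hh : ∀ᵐ x ∂(riemVol n M), 0 ≤ h x)
    (hu : MemW0C1 (n := n) p u) (hv : MemW0C1 (n := n) p v)
    (hu0 : ∀ x, 0 < u x) (hv0 : ∀ x, 0 < v x)
    (hus : WeakSupersolution (n := n) p u (fun x => h x * f (u x)))
    (hvs : WeakSubsolution (n := n) p v (fun x => h x * f (v x))) {ε : ℝ} (hε : 0 < ε) :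
    ∃ K : ℝ, 0 ≤ K ∧ ∀ ζ : M → ℝ, ContMDiff (𝓡 n) 𝓘(ℝ, ℝ) 1 ζ → HasCompactSupport ζ →
      (∀ x, 0 ≤ ζ x) → (∀ x, ζ x ≤ 1) →
      ∫⁻ x, ENNReal.ofReal (gap n p f h u v (ζ x) x) ∂(riemVol n M) ≤
        ENNReal.ofReal (ε * ∫ x, (‖grad (n := n) u x‖ ^ p + ‖grad (n := n) v x‖ ^ p) ∂(riemVol n M)
          + K * ∫ x, ‖v x • grad (n := n) ζ x‖ ^ p ∂(riemVol n M)) := by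
  obtain ⟨C, hC0, hC⟩ := exists_deriv_smoothTransition_le
  obtain ⟨K, hK0, hK⟩ := exists_absorb hp hε (K₀ := (2 * p + C) * 2 ^ p) (by positivity)
  refine ⟨K, hK0, fun ζ hζ hζc hζ0 hζ1 => ?_⟩
  have hTu := contMDiff_superTest hp hu.1 hv.1 hζ hu0
  have hTv := contMDiff_subTest hp hu.1 hv.1 hζ hu0
  have hTuc : HasCompactSupport (superTest p u v ζ) := hasCompactSupport_superTest hp hζc
  have hTvc : HasCompactSupport (subTest p u v ζ) := hasCompactSupport_subTest hp hζc
  have i1 := integrable_mul_of_locallyIntegrable hus.1 hTu.continuous hTuc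
  have i2 := integrable_mul_of_locallyIntegrable hvs.1 hTv.continuous hTvc
  have i3 := integrable_inner_pFlux_grad hp hu.1 hTu hTuc
  have i4 := integrable_inner_pFlux_grad hp hv.1 hTv hTvc
  have i5 := (hu.integrable_norm_grad_rpow hp).add (hv.integrable_norm_grad_rpow hp)
  have i6 := integrable_norm_smul_grad_rpow (n := n) hp hv.1 hζ hζc
  have hle1 := hus.le_pLaplacePairing hp hu.1 hTu hTuc (superTest_nonneg hu0 hv0 hζ0)
  have hle2 := hvs.pLaplacePairing_le hp hv.1 hTv hTvc (subTest_nonneg hv0 hζ0)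
  rw [pLaplacePairing_eq] at hle1 hle2
  set G : M → ℝ := fun x => ((h x * f (u x) * superTest p u v ζ x -
      h x * f (v x) * subTest p u v ζ x) -
      (inner ℝ (pFlux p (grad (n := n) u x)) (grad (n := n) (superTest p u v ζ) x) -
        inner ℝ (pFlux p (grad (n := n) v x)) (grad (n := n) (subTest p u v ζ) x))) +
      (ε * (‖grad (n := n) u x‖ ^ p + ‖grad (n := n) v x‖ ^ p) +
        K * ‖v x • grad (n := n) ζ x‖ ^ p) with hG
  have hGi : Integrable G (riemVol n M) :=
    ((i1.sub i2).sub (i3.sub i4)).add ((i5.const_mul ε).add (i6.const_mul K))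
  have hgapG : ∀ x, gap n p f h u v (ζ x) x ≤ G x := by
    intro x
    set r := v x * ζ x / u x with hr
    have hr0 : 0 ≤ r := div_nonneg (mul_nonneg (hv0 x).le (hζ0 x)) (hu0 x).le
    have h1 := picone_le hp (hu0 x) (hζ0 x) (hζ1 x) hr hr0
      (Real.smoothTransition.nonneg (r - 1)) (Real.smoothTransition.le_one (r - 1))
      (deriv_smoothTransition_nonneg (r - 1)) (hC (r - 1)) (fun h0 => by
        have := mem_Icc_of_deriv_smoothTransition_ne_zero h0
        constructor <;> linarith [this.1, this.2])
      (grad (n := n) u x) (grad (n := n) v x) (v x • grad (n := n) ζ x)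
    have h2 := hK _ _ _ (norm_nonneg (grad (n := n) u x)) (norm_nonneg (grad (n := n) v x))
      (norm_nonneg (v x • grad (n := n) ζ x))
    rw [← grad_superTest hp hu.1 hv.1 hζ hu0 hr rfl rfl,
      ← grad_subTest hp hu.1 hv.1 hζ hu0 hr rfl rfl] at h1
    simp only [hG, gap, superTest, subTest] at h1 ⊢
    rw [← hr]
    linarith
  have hgap0 : ∀ᵐ x ∂(riemVol n M), 0 ≤ G x := by
    filter_upwards [hh] with x hx
    exact (gap_nonneg hp hf (hu0 x) (hv0 x) hx (hζ0 x) (hζ1 x)).trans (hgapG x)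
  calc ∫⁻ x, ENNReal.ofReal (gap n p f h u v (ζ x) x) ∂(riemVol n M)
      ≤ ∫⁻ x, ENNReal.ofReal (G x) ∂(riemVol n M) :=
        lintegral_mono fun x => ENNReal.ofReal_le_ofReal (hgapG x)
    _ = ENNReal.ofReal (∫ x, G x ∂(riemVol n M)) :=
        (ofReal_integral_eq_lintegral_ofReal hGi hgap0).symm
    _ ≤ _ := by
        refine ENNReal.ofReal_le_ofReal ?_
        have e1 : ∫ x, G x ∂(riemVol n M) = _ :=
          integral_add ((i1.sub i2).sub (i3.sub i4)) ((i5.const_mul ε).add (i6.const_mul K))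
        have e2 := integral_sub (i1.sub i2) (i3.sub i4)
        have e3 := integral_sub i1 i2
        have e4 := integral_sub i3 i4
        have e5 := integral_add (i5.const_mul ε) (i6.const_mul K)
        simp only [Pi.sub_apply, Pi.add_apply, integral_const_mul] at e1 e2 e3 e4 e5
        linarith

end Energy

/-! ### Cut-off functions -/

section Cutoff

variable {n : ℕ} {M : Type*} [TopologicalSpace M]
  [ChartedSpace (EuclideanSpace ℝ (Fin n)) M] [IsManifold (𝓡 n) ∞ M]
  [RiemannianBundle (fun x : M => TangentSpace (𝓡 n) x)]
  [IsContMDiffRiemannianBundle (𝓡 n) ∞ (EuclideanSpace ℝ (Fin n))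
      (fun x : M => TangentSpace (𝓡 n) x)]
  [T2Space M] [SigmaCompactSpace M] [MeasurableSpace M] [BorelSpace M]

/-- A positive function of `W₀^{1,p}` provides cut-offs `ζ_k = smoothTransition (φ_k / v)` that are
efficient with respect to the weight `v`. -/
theorem MemW0C1.exists_cutoff {p : ℝ} (hp : 1 < p) {v : M → ℝ} (hv : MemW0C1 (n := n) p v)
    (hv0 : ∀ x, 0 < v x) :
    ∃ ζ : ℕ → M → ℝ, (∀ k, ContMDiff (𝓡 n) 𝓘(ℝ, ℝ) 1 (ζ k)) ∧ (∀ k, HasCompactSupport (ζ k)) ∧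
      (∀ k x, 0 ≤ ζ k x) ∧ (∀ k x, ζ k x ≤ 1) ∧
      Tendsto (fun k => ∫ x, ‖v x • grad (n := n) (ζ k) x‖ ^ p ∂(riemVol n M)) atTop (𝓝 0) ∧
      ∀ᵐ x ∂(riemVol n M), Tendsto (fun k => ζ k x) atTop (𝓝 1) := by
  have hp0 : 0 < p := by linarith
  obtain ⟨φ, h1, h2, h3, h4, h5⟩ := hv.exists_seq hp
  obtain ⟨C, hC0, hC⟩ := exists_deriv_smoothTransition_le
  have hφ1 : ∀ k, ContMDiff (𝓡 n) 𝓘(ℝ, ℝ) 1 (φ k) := fun k => (h1 k).of_le (by simp)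
  set t : ℕ → M → ℝ := fun k x => φ k x / v x with ht
  have ht1 : ∀ k, ContMDiff (𝓡 n) 𝓘(ℝ, ℝ) 1 (t k) := fun k => contMDiff_div (hφ1 k) hv.1 hv0
  set ζ : ℕ → M → ℝ := fun k x => Real.smoothTransition (t k x) with hζ
  have hζ1 : ∀ k, ContMDiff (𝓡 n) 𝓘(ℝ, ℝ) 1 (ζ k) := fun k =>
    (Real.smoothTransition.contDiff (n := 1)).contMDiff.comp (ht1 k)
  have hζc : ∀ k, HasCompactSupport (ζ k) := fun k => (h2 k).mono fun x hx h0 => hx (by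
    simp only [hζ, ht]
    rw [h0, zero_div, Real.smoothTransition.zero])
  have htl : ∀ᵐ x ∂(riemVol n M), Tendsto (fun k => t k x) atTop (𝓝 1) := by
    filter_upwards [h5] with x hx
    have := hx.div_const (v x)
    rwa [div_self (hv0 x).ne'] at this
  set m : ℕ → M → ℝ := fun k x => |deriv Real.smoothTransition (t k x) * (1 - t k x)| with hm
  have hmC : ∀ k x, m k x ≤ C := by
    intro k x
    simp only [hm]
    by_cases h0 : deriv Real.smoothTransition (t k x) = 0
    · rw [h0, zero_mul, abs_zero]; exact hC0
    · have h6 := mem_Icc_of_deriv_smoothTransition_ne_zero h0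
      rw [abs_mul, abs_of_nonneg (deriv_smoothTransition_nonneg _), abs_of_nonneg (by linarith [h6.2])]
      calc _ ≤ C * 1 := mul_le_mul (hC _) (by linarith [h6.1]) (by linarith [h6.2]) hC0
        _ = C := mul_one C
  have hgrad : ∀ k x, v x • grad (n := n) (ζ k) x = deriv Real.smoothTransition (t k x) •
      (grad (n := n) (φ k) x - t k x • grad (n := n) v x) := by
    intro k x
    have h6 := ((hasGradAt_grad (hφ1 k) x).div (hasGradAt_grad hv.1 x) (hv0 x).ne').comp_real
      (hasDerivAt_smoothTransition (t k x))
    have h7 : grad (n := n) (ζ k) x = _ := h6.2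
    rw [h7, smul_comm (v x), smul_smul (v x), mul_inv_cancel₀ (hv0 x).ne', one_smul]
  have hbound : ∀ k x, ‖v x • grad (n := n) (ζ k) x‖ ^ p ≤
      2 ^ p * (C ^ p * ‖grad (n := n) v x - grad (n := n) (φ k) x‖ ^ p +
        m k x ^ p * ‖grad (n := n) v x‖ ^ p) := by
    intro k x
    have h6 : ‖v x • grad (n := n) (ζ k) x‖ ≤
        C * ‖grad (n := n) v x - grad (n := n) (φ k) x‖ + m k x * ‖grad (n := n) v x‖ := by
      rw [hgrad]
      have e : deriv Real.smoothTransition (t k x) •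
          (grad (n := n) (φ k) x - t k x • grad (n := n) v x) =
          (-deriv Real.smoothTransition (t k x)) • (grad (n := n) v x - grad (n := n) (φ k) x) +
          (deriv Real.smoothTransition (t k x) * (1 - t k x)) • grad (n := n) v x := by
        module
      rw [e]
      refine (norm_add_le _ _).trans ?_
      rw [norm_smul, norm_smul, norm_neg, Real.norm_of_nonneg (deriv_smoothTransition_nonneg _),
        Real.norm_eq_abs]
      gcongr
      exact hC _
    have hm0 : 0 ≤ m k x := abs_nonneg _
    set A := C * ‖grad (n := n) v x - grad (n := n) (φ k) x‖ with hA
    set B := m k x * ‖grad (n := n) v x‖ with hB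
    have hA0 : 0 ≤ A := by positivity
    have hB0 : 0 ≤ B := by positivity
    rw [← Real.mul_rpow hC0 (norm_nonneg _), ← Real.mul_rpow hm0 (norm_nonneg _), ← hA, ← hB]
    calc _ ≤ (A + B) ^ p := Real.rpow_le_rpow (norm_nonneg _) h6 hp0.le
      _ ≤ (2 * max A B) ^ p := by
          refine Real.rpow_le_rpow (by positivity) ?_ hp0.le
          linarith [le_max_left A B, le_max_right A B]
      _ = 2 ^ p * max A B ^ p := Real.mul_rpow (by norm_num) (by positivity)
      _ ≤ 2 ^ p * (A ^ p + B ^ p) := by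
          gcongr
          rcases max_choice A B with h | h <;> rw [h]
          · exact le_add_of_nonneg_right (by positivity)
          · exact le_add_of_nonneg_left (by positivity)
  have hmcont : ∀ k, Continuous (m k) := fun k =>
    ((continuous_deriv_smoothTransition.comp (ht1 k).continuous).mul
      (continuous_const.sub (ht1 k).continuous)).abs
  have hYi := hv.integrable_norm_grad_rpow hp
  have hmeas : ∀ k, AEStronglyMeasurable (fun x => m k x ^ p * ‖grad (n := n) v x‖ ^ p)
      (riemVol n M) := fun k =>
    (((hmcont k).rpow_const fun _ => Or.inr hp0.le).mul
      ((continuous_norm_grad hv.1).rpow_const fun _ => Or.inr hp0.le)).aestronglyMeasurable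
  have hmb : ∀ k, ∀ᵐ x ∂(riemVol n M), ‖m k x ^ p * ‖grad (n := n) v x‖ ^ p‖ ≤
      C ^ p * ‖grad (n := n) v x‖ ^ p := fun k => .of_forall fun x => by
    have hm0 : 0 ≤ m k x := abs_nonneg _
    rw [Real.norm_of_nonneg (by positivity)]
    gcongr
    exact hmC k x
  have hmlim : Tendsto (fun k => ∫ x, m k x ^ p * ‖grad (n := n) v x‖ ^ p ∂(riemVol n M)) atTop
      (𝓝 0) := by
    have := tendsto_integral_of_dominated_convergence (f := fun _ => (0 : ℝ)) _ hmeas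
      (hYi.const_mul (C ^ p)) hmb (by
        filter_upwards [htl] with x hx
        have h6 : Tendsto (fun k => m k x) atTop
            (𝓝 |deriv Real.smoothTransition 1 * (1 - 1)|) :=
          (((continuous_deriv_smoothTransition.tendsto _).comp hx).mul (hx.const_sub 1)).abs
        rw [sub_self, mul_zero, abs_zero] at h6
        have h7 := (h6.rpow_const (p := p) (Or.inr hp0.le)).mul_const (‖grad (n := n) v x‖ ^ p)
        rwa [Real.zero_rpow hp0.ne', zero_mul] at h7)
    simpa using this
  refine ⟨ζ, hζ1, hζc, fun k x => Real.smoothTransition.nonneg _,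
    fun k x => Real.smoothTransition.le_one _, ?_, ?_⟩
  · refine squeeze_zero (fun k => integral_nonneg fun x => by positivity)
      (g := fun k => 2 ^ p * (C ^ p *
        ∫ x, ‖grad (n := n) v x - grad (n := n) (φ k) x‖ ^ p ∂(riemVol n M) +
        ∫ x, m k x ^ p * ‖grad (n := n) v x‖ ^ p ∂(riemVol n M))) (fun k => ?_) ?_
    · have i2 : Integrable (fun x => m k x ^ p * ‖grad (n := n) v x‖ ^ p) (riemVol n M) :=
        (hYi.const_mul (C ^ p)).mono' (hmeas k) (hmb k)
      rw [← integral_const_mul, ← integral_add ((h3 k).const_mul _) i2, ← integral_const_mul]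
      exact integral_mono (integrable_norm_smul_grad_rpow hp hv.1 (hζ1 k) (hζc k))
        ((((h3 k).const_mul _).add i2).const_mul _) (hbound k)
    · simpa using ((h4.const_mul (C ^ p)).add hmlim).const_mul (2 ^ p)
  · filter_upwards [htl] with x hx
    have := (Real.smoothTransition.continuous.tendsto 1).comp hx
    rwa [Real.smoothTransition.one] at this

end Cutoff

/-! ### The comparison principle -/

section Comparison

variable {n : ℕ} {M : Type*} [TopologicalSpace M]
  [ChartedSpace (EuclideanSpace ℝ (Fin n)) M] [IsManifold (𝓡 n) ∞ M]
  [RiemannianBundle (fun x : M => TangentSpace (𝓡 n) x)]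
  [IsContMDiffRiemannianBundle (𝓡 n) ∞ (EuclideanSpace ℝ (Fin n))
      (fun x : M => TangentSpace (𝓡 n) x)]
  [T2Space M] [SigmaCompactSpace M] [MeasurableSpace M] [BorelSpace M]
  {p : ℝ} {f : ℝ → ℝ} {h u v : M → ℝ}

theorem ae_gap_one_eq_zero (hp : 1 < p)
    (hf : StrictAntiOn (fun s => f s / s ^ (p - 1)) (Ioi 0))
    (hh : ∀ᵐ x ∂(riemVol n M), 0 ≤ h x)
    (hu : MemW0C1 (n := n) p u) (hv : MemW0C1 (n := n) p v)
    (hu0 : ∀ x, 0 < u x) (hv0 : ∀ x, 0 < v x)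
    (hus : WeakSupersolution (n := n) p u (fun x => h x * f (u x)))
    (hvs : WeakSubsolution (n := n) p v (fun x => h x * f (v x))) :
    ∀ᵐ x ∂(riemVol n M), gap n p f h u v 1 x = 0 := by
  obtain ⟨ζ, hζ1, hζc, hζ0, hζle, hζt, hζl⟩ := hv.exists_cutoff hp hv0
  set μ := riemVol n M
  have hmeas : ∀ k, AEMeasurable (fun x => ENNReal.ofReal (gap n p f h u v (ζ k x) x)) μ :=
    fun k => (aemeasurable_gap hp hu.1 hv.1 hu0 hv0 hus.1 hvs.1 (hζ1 k) (hζc k)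
      (hζ0 k)).ennreal_ofReal
  have hlim : ∀ᵐ x ∂μ, Tendsto (fun k => ENNReal.ofReal (gap n p f h u v (ζ k x) x)) atTop
      (𝓝 (ENNReal.ofReal (gap n p f h u v 1 x))) := by
    filter_upwards [hζl] with x hx
    exact ENNReal.tendsto_ofReal (tendsto_gap hp (hu0 x) (hv0 x) (fun k => hζ0 k x) hx)
  set A := ∫ x, (‖grad (n := n) u x‖ ^ p + ‖grad (n := n) v x‖ ^ p) ∂μ with hA
  have hle : ∀ ε : ℝ, 0 < ε → ∫⁻ x, ENNReal.ofReal (gap n p f h u v 1 x) ∂μ ≤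
      ENNReal.ofReal (ε * A) := by
    intro ε hε
    obtain ⟨K, hK0, hK⟩ := exists_lintegral_gap_le hp hf hh hu hv hu0 hv0 hus hvs hε
    have h1 : Tendsto (fun k => ENNReal.ofReal (ε * A +
        K * ∫ x, ‖v x • grad (n := n) (ζ k) x‖ ^ p ∂μ)) atTop (𝓝 (ENNReal.ofReal (ε * A))) := by
      have := (hζt.const_mul K).const_add (ε * A)
      rw [mul_zero, add_zero] at this
      exact ENNReal.tendsto_ofReal this
    calc ∫⁻ x, ENNReal.ofReal (gap n p f h u v 1 x) ∂μ
        = ∫⁻ x, liminf (fun k => ENNReal.ofReal (gap n p f h u v (ζ k x) x)) atTop ∂μ :=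
          lintegral_congr_ae (hlim.mono fun x hx => hx.liminf_eq.symm)
      _ ≤ liminf (fun k => ∫⁻ x, ENNReal.ofReal (gap n p f h u v (ζ k x) x) ∂μ) atTop :=
          lintegral_liminf_le' hmeas
      _ ≤ liminf (fun k => ENNReal.ofReal (ε * A +
            K * ∫ x, ‖v x • grad (n := n) (ζ k) x‖ ^ p ∂μ)) atTop :=
          liminf_le_liminf (.of_forall fun k => hK (ζ k) (hζ1 k) (hζc k) (hζ0 k) (hζle k))
      _ = ENNReal.ofReal (ε * A) := h1.liminf_eq
  have hzero : ∫⁻ x, ENNReal.ofReal (gap n p f h u v 1 x) ∂μ = 0 := by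
    have h1 : Tendsto (fun ε : ℝ => ENNReal.ofReal (ε * A)) (𝓝[>] 0) (𝓝 0) := by
      have : Tendsto (fun ε : ℝ => ENNReal.ofReal (ε * A)) (𝓝 0) (𝓝 (ENNReal.ofReal (0 * A))) :=
        ENNReal.tendsto_ofReal (tendsto_id.mul_const A)
      rw [zero_mul, ENNReal.ofReal_zero] at this
      exact this.mono_left nhdsWithin_le_nhds
    exact le_antisymm (ge_of_tendsto h1 (eventually_nhdsWithin_of_forall hle)) zero_le
  have hm1 : AEMeasurable (fun x => ENNReal.ofReal (gap n p f h u v 1 x)) μ :=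
    aemeasurable_of_tendsto_metrizable_ae atTop hmeas hlim
  rw [lintegral_eq_zero_iff' hm1] at hzero
  filter_upwards [hzero, hh] with x hx hhx
  exact le_antisymm (ENNReal.ofReal_eq_zero.1 hx)
    (gap_nonneg hp hf (hu0 x) (hv0 x) hhx zero_le_one le_rfl)

theorem deriv_mul_grad_ratio_eq_zero (hp : 1 < p)
    (hf : StrictAntiOn (fun s => f s / s ^ (p - 1)) (Ioi 0))
    (hh : ∀ᵐ x ∂(riemVol n M), 0 ≤ h x)
    (hu : MemW0C1 (n := n) p u) (hv : MemW0C1 (n := n) p v)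
    (hu0 : ∀ x, 0 < u x) (hv0 : ∀ x, 0 < v x)
    (hgap : ∀ᵐ x ∂(riemVol n M), gap n p f h u v 1 x = 0) (x : M)
    (hx : deriv Real.smoothTransition (v x / u x - 1) ≠ 0) :
    grad (n := n) (fun y => v y / u y) x = 0 := by
  have := isOpenPosMeasure_riemVol (n := n) (M := M)
  have hc := continuous_defect (ζ := fun _ => 1) hp hu.1 hv.1 hu0 hv0 continuous_const
    fun _ => zero_le_one
  have hae : (fun x => deriv Real.smoothTransition (v x * 1 / u x - 1) * (v x * 1 / u x) *
      pDefect p ((v x * 1 / u x) • grad (n := n) u x) ((1 : ℝ) • grad (n := n) v x))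
      =ᵐ[riemVol n M] fun _ => 0 := by
    filter_upwards [hgap, hh] with y hy hhy
    have h1 := source_gap_nonneg hf (hu0 y) (hv0 y) zero_le_one le_rfl hhy
    have h2 := mul_nonneg (mul_nonneg (deriv_smoothTransition_nonneg (v y * 1 / u y - 1))
      (div_nonneg (mul_nonneg (hv0 y).le zero_le_one) (hu0 y).le))
      (pDefect_nonneg hp ((v y * 1 / u y) • grad (n := n) u y) ((1 : ℝ) • grad (n := n) v y))
    rw [gap] at hy
    linarith
  have h0 := congrFun ((hc.ae_eq_iff_eq _ continuous_const).1 hae) x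
  simp only [mul_one, one_smul] at h0
  have hr : 0 < v x / u x := div_pos (hv0 x) (hu0 x)
  rcases mul_eq_zero.1 h0 with h1 | h1
  · exact absurd h1 (mul_ne_zero hx hr.ne')
  · rw [((hasGradAt_grad hv.1 x).div (hasGradAt_grad hu.1 x) (hu0 x).ne').2,
      eq_of_pDefect_eq_zero hp h1, sub_self, smul_zero]

end Comparison

end RiemPLaplace

end


theorem lemma8 {n : ℕ} {M : Type*} [TopologicalSpace M] [T2Space M] [SigmaCompactSpace M]
    [ConnectedSpace M] [ChartedSpace (EuclideanSpace ℝ (Fin n)) M] [IsManifold (𝓡 n) ∞ M]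
    [RiemannianBundle (fun x : M => TangentSpace (𝓡 n) x)]
    [IsContMDiffRiemannianBundle (𝓡 n) ∞ (EuclideanSpace ℝ (Fin n))
      (fun x : M => TangentSpace (𝓡 n) x)]
    [MeasurableSpace M] [BorelSpace M]
    (p : ℝ) (hp : 1 < p)
    (f : ℝ → ℝ) (hf_cont : ContinuousOn f (Ioi 0)) (hf_pos : ∀ s, 0 < s → 0 < f s)
    (hf_anti : StrictAntiOn (fun s => f s / s ^ (p - 1)) (Ioi 0))
    (h : M → ℝ) (h_nonneg : ∀ᵐ x ∂(RiemPLaplace.riemVol n M), 0 ≤ h x)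
    (h_ne : ¬ ∀ᵐ x ∂(RiemPLaplace.riemVol n M), h x = 0)
    (u v : M → ℝ)
    (hu : RiemPLaplace.MemW0C1 (n := n) p u) (hv : RiemPLaplace.MemW0C1 (n := n) p v)
    (hu_pos : ∀ x, 0 < u x) (hv_pos : ∀ x, 0 < v x)
    (hu_super : RiemPLaplace.WeakSupersolution (n := n) p u (fun x => h x * f (u x)))
    (hv_sub : RiemPLaplace.WeakSubsolution (n := n) p v (fun x => h x * f (v x))) :
    ∀ x, v x ≤ u x := by
  have hgap := RiemPLaplace.ae_gap_one_eq_zero hp hf_anti h_nonneg hu hv hu_pos hv_pos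
    hu_super hv_sub
  set r : M → ℝ := fun x => v x / u x with hr
  have hr1 : ContMDiff (𝓡 n) 𝓘(ℝ, ℝ) 1 r := RiemPLaplace.contMDiff_div hv.1 hu.1 hu_pos
  -- since `h` does not vanish almost everywhere, `v > u` cannot hold everywhere
  obtain ⟨x₀, hx₀⟩ : ∃ x₀, r x₀ ≤ 1 := by
    by_contra! hall
    refine h_ne ?_
    filter_upwards [hgap, h_nonneg] with x hx hhx
    have h1 := RiemPLaplace.source_gap_nonneg hf_anti (hu_pos x) (hv_pos x) zero_le_one le_rfl hhx
    have h2 := mul_nonneg (mul_nonneg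
      (RiemPLaplace.deriv_smoothTransition_nonneg (v x * 1 / u x - 1))
      (div_nonneg (mul_nonneg (hv_pos x).le zero_le_one) (hu_pos x).le))
      (RiemPLaplace.pDefect_nonneg hp ((v x * 1 / u x) • RiemPLaplace.grad (n := n) u x)
        ((1 : ℝ) • RiemPLaplace.grad (n := n) v x))
    rw [RiemPLaplace.gap] at hx
    have h3 := le_antisymm (by linarith) h1
    rw [RiemPLaplace.source_gap_eq (hu_pos x) (hv_pos x) zero_le_one, mul_one] at h3
    have hrx : 1 < v x / u x := hall x
    have hux := hu_pos x
    have hvx := hv_pos x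
    have huv : u x < v x := by rwa [lt_div_iff₀ hux, one_mul] at hrx
    have h4 := hf_anti hux hvx huv
    simp only at h4
    have h5 := Real.smoothTransition.pos_of_pos (show 0 < v x / u x - 1 by linarith)
    have h6 : 0 < v x ^ p := Real.rpow_pos_of_pos hvx p
    rcases mul_eq_zero.1 h3 with h7 | h7
    · exact (mul_eq_zero.1 h7).resolve_right (mul_pos h6 h5).ne'
    · linarith
  intro x₁
  by_contra! hlt
  have hx₁ : 1 < r x₁ := by
    simp only [hr]
    rwa [lt_div_iff₀ (hu_pos x₁), one_mul]
  -- a level `c` between the values of `r` at which the transition function increases strictly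
  obtain ⟨c, hc1, hc2, hc⟩ : ∃ c, 1 < c ∧ c < r x₁ ∧
      deriv Real.smoothTransition (c - 1) ≠ 0 := by
    obtain ⟨ξ, hξ, hd⟩ := exists_deriv_eq_slope Real.smoothTransition
      (show (0 : ℝ) < r x₁ - 1 by linarith) Real.smoothTransition.continuous.continuousOn
      (fun s _ => (RiemPLaplace.hasDerivAt_smoothTransition s).differentiableAt.differentiableWithinAt)
    refine ⟨ξ + 1, by linarith [hξ.1], by linarith [hξ.2], ?_⟩
    rw [add_sub_cancel_right, hd, Real.smoothTransition.zero, sub_zero, sub_zero]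
    exact (div_pos (Real.smoothTransition.pos_of_pos (by linarith)) (by linarith)).ne'
  obtain ⟨x₂, hx₂⟩ : c ∈ range r :=
    mem_range_of_exists_le_of_exists_ge hr1.continuous ⟨x₀, hx₀.trans hc1.le⟩ ⟨x₁, hc2.le⟩
  -- near the level set `{r = c}` the gradient of `r` vanishes, so the level set is open
  have hopen : IsOpen {x | r x = c} := by
    rw [isOpen_iff_mem_nhds]
    intro x hx
    have hev : ∀ᶠ y in 𝓝 x, RiemPLaplace.grad (n := n) r y = 0 := by
      have hcont : Continuous fun y => deriv Real.smoothTransition (r y - 1) :=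
        RiemPLaplace.continuous_deriv_smoothTransition.comp (hr1.continuous.sub continuous_const)
      have hx' : deriv Real.smoothTransition (r x - 1) ≠ 0 := by
        rw [show r x = c from hx]; exact hc
      filter_upwards [hcont.continuousAt.eventually_ne hx'] with y hy
      exact RiemPLaplace.deriv_mul_grad_ratio_eq_zero hp hf_anti h_nonneg hu hv hu_pos hv_pos
        hgap y hy
    filter_upwards [RiemPLaplace.eventually_eq_of_grad_eq_zero hr1 hev] with y hy
    exact hy.trans hx
  have hclopen : IsClopen {x | r x = c} := ⟨isClosed_eq hr1.continuous continuous_const, hopen⟩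
  have huniv := hclopen.eq_univ ⟨x₂, hx₂⟩
  have hx₀c : x₀ ∈ {x | r x = c} := by rw [huniv]; exact mem_univ x₀
  have : r x₀ = c := hx₀c
  linarith
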